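/- Write $[n]=\{1,\dots,n\}$. There is a function $f:\mathbb N\to\mathbb N$, $k\mapsto f_k$, with $f_k=O(2^{k/2})$, such that the following holds for every $n,k$ and every symmetric $n\times n$ matrix $A=(A_{ij})$ with entries in $\{0,1\}$, zero diagonal and (real) rank $k$. (1) The rows of $A$ can be partitioned into at most $f_k$ classes such that any two rows in the same class are identical. (2) Let $P_1,\dots,P_K$ be any partition of $[n]$ (empty classes allowed; in particular $K=f_k$ as in (1)) such that the rows of $A$ in the same class are identical. Let $\mathcal P(i)$ be the index of the class of $i$, and let $\tilde a_{st}=1$ if $A_{im}=1$ for all $i\in P_s$, $m\in P_t$, and $\tilde a_{st}=0$ otherwise. Let $a_1,\dots,a_n\ge 0$, $\ell_n\ge 0$, $i_0\in[n]$ and $B=\operatorname{diag}(a_1,\dots,a_n)\,A\,\operatorname{diag}(a_1,\dots,a_n)$. Consider - the marked $K$-type branching process $\mathsf{MBP}_K(i_0)$: the root has mark $i_0$; a particle with mark $i$ has, independently for $j\in[K]$, $\mathrm{Poi}\bigl(\ell_n a_i\tilde a_{\mathcal P(i)j}\sum_{m\in P_j}a_m\bigr)$ children of type $j$; each child of type $j$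 independently receives the mark $m\in P_j$ with probability $a_m/\sum_{m'\in P_j}a_{m'}$ (if this sum is $0$, there are no children of type $j$); - the $n$-type branching process $\mathsf{BP}(i_0)$ of $B$: the root has type $i_0$; a particle of type $i$ has, independently for $j\in[n]$, $\mathrm{Poi}(\ell_n B_{ij})$ children of type $j$. In both processes different particles reproduce independently. Then $\mathsf{MBP}_K(i_0)$, with every particle labelled by its mark, has the same distribution as $\mathsf{BP}(i_0)$, with every particle labelled by its type; that is, the random labelled family trees (rooted trees with unordered siblings, observed through their first $l$ generations for all $l$ jointly) have the same law. -/

import Mathlib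

open MeasureTheory ProbabilityTheory
open scoped NNReal ENNReal

noncomputable section

namespace RankOneKL

/-- Isomorphism classes of rooted trees of height at most `l` (the first `l` generations of a
family tree) whose vertices carry labels in `α`; siblings are not ordered. -/
def LabelledTree (α : Type) : ℕ → Type
  | 0 => α
  | l + 1 => α × Multiset (LabelledTree α l)

instance instCountableLabelledTree (α : Type) [Countable α] :
    ∀ l, Countable (LabelledTree α l)
  | 0 => inferInstanceAs (Countable α)
  | l + 1 =>
    haveI := instCountableLabelledTree α l
    inferInstanceAs (Countable (α × Multiset (LabelledTree α l)))

instance instMeasurableSpaceLabelledTree (α : Type) (l : ℕ) :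
    MeasurableSpace (LabelledTree α l) := ⊤

instance instDiscreteLabelledTree (α : Type) (l : ℕ) :
    DiscreteMeasurableSpace (LabelledTree α l) := ⟨fun _ => trivial⟩

/-- The randomness attached to one potential particle of a branching process with marks `Fin n`
and types `Fin K`: the first component at `(i, t)` is the number of type-`t` children the particle
has in case its mark is `i`; the second component at `t` is the mark the particle receives in
case its type is `t`. -/
abbrev Noise (n K : ℕ) : Type := (Fin n → Fin K → ℕ) × (Fin K → Fin n)

/-- All these variables are independent; the numbers of children are Poisson with mean
`rate i t`, and a type-`t` particle receives a mark with law `mark t`. -/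
def noiseLaw {n K : ℕ} (rate : Fin n → Fin K → ℝ≥0) (mark : Fin K → PMF (Fin n)) :
    Measure (Noise n K) :=
  (Measure.pi fun i => Measure.pi fun t => poissonMeasure (rate i t)).prod
    (Measure.pi fun t => (mark t).toMeasure)

instance instProbNoiseLaw {n K : ℕ} (rate : Fin n → Fin K → ℝ≥0) (mark : Fin K → PMF (Fin n)) :
    IsProbabilityMeasure (noiseLaw rate mark) := by
  unfold noiseLaw; infer_instance

/-- The family tree up to generation `l` of a particle with mark `i`, each particle being labelled
by its mark. Potential descendants are indexed by words: the letter `(t, r)` leads to the `r`-th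
child of type `t`, which is present if and only if `r` is less than the number of type-`t`
children. -/
def familyTree {n K : ℕ} :
    (l : ℕ) → Fin n → (List (Fin K × ℕ) → Noise n K) → LabelledTree (Fin n) l
  | 0, i, _ => i
  | l + 1, i, ω =>
    (i, ∑ t : Fin K, ∑ r ∈ Finset.range ((ω []).1 i t),
      ({familyTree l ((ω [(t, r)]).2 t) fun w => ω ((t, r) :: w)} :
        Multiset (LabelledTree (Fin n) l)))

theorem measurable_familyTree {n K : ℕ} (l : ℕ) :
    ∀ i : Fin n, Measurable (familyTree (K := K) l i) := by
  induction l with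
  | zero => intro i; exact measurable_const
  | succ l ih =>
    intro i
    let _ : MeasurableSpace (Multiset (LabelledTree (Fin n) l)) := ⊤
    have : DiscreteMeasurableSpace (Multiset (LabelledTree (Fin n) l)) := ⟨fun _ => trivial⟩
    have hadd : MeasurableAdd₂ (Multiset (LabelledTree (Fin n) l)) := ⟨.of_discrete⟩
    let root : Multiset (LabelledTree (Fin n) l) → LabelledTree (Fin n) (l + 1) := fun s => (i, s)
    have hroot : Measurable root := .of_discrete
    refine hroot.comp (Finset.measurable_sum _ fun t _ => ?_)
    have hsub : ∀ r : ℕ, Measurable fun ω : List (Fin K × ℕ) → Noise n K =>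
        ({familyTree l ((ω [(t, r)]).2 t) fun w => ω ((t, r) :: w)} :
          Multiset (LabelledTree (Fin n) l)) := by
      intro r
      have hm : Measurable fun ω : List (Fin K × ℕ) → Noise n K => (ω [(t, r)]).2 t := by fun_prop
      have hs : Measurable fun (ω : List (Fin K × ℕ) → Noise n K) (w : List (Fin K × ℕ)) =>
          ω ((t, r) :: w) := by fun_prop
      have hj : Measurable fun p : (List (Fin K × ℕ) → Noise n K) × Fin n =>
          familyTree l p.2 p.1 := measurable_from_prod_countable_left ih
      have hsing : Measurable fun x : LabelledTree (Fin n) l =>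
          ({x} : Multiset (LabelledTree (Fin n) l)) := .of_discrete
      exact hsing.comp (hj.comp (hs.prodMk hm))
    have hN : Measurable fun ω : List (Fin K × ℕ) → Noise n K => (ω []).1 i t := by fun_prop
    have hsum : Measurable fun p : (List (Fin K × ℕ) → Noise n K) × ℕ =>
        ∑ r ∈ Finset.range p.2,
          ({familyTree l ((p.1 [(t, r)]).2 t) fun w => p.1 ((t, r) :: w)} :
            Multiset (LabelledTree (Fin n) l)) :=
      measurable_from_prod_countable_left fun N =>
        Finset.measurable_sum (Finset.range N) fun r _ => hsub r
    exact hsum.comp (measurable_id.prodMk hN)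

/-- The law of the marked `K`-type branching process started from a particle with mark `i₀`: the
joint law of the mark-labelled family trees up to generation `l`, for all `l`. Independently of
everything else, a particle with mark `i` has a Poisson number with mean `rate i t` of children of
each type `t`, and each child of type `t` receives a mark with law `mark t`. -/
def markedBPLaw {n K : ℕ} (rate : Fin n → Fin K → ℝ≥0) (mark : Fin K → PMF (Fin n))
    (i₀ : Fin n) : Measure ((l : ℕ) → LabelledTree (Fin n) l) :=
  (Measure.infinitePi fun _ : List (Fin K × ℕ) => noiseLaw rate mark).map
    fun ω l => familyTree l i₀ ω

instance instProbMarkedBPLaw {n K : ℕ} (rate : Fin n → Fin K → ℝ≥0)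
    (mark : Fin K → PMF (Fin n)) (i₀ : Fin n) :
    IsProbabilityMeasure (markedBPLaw rate mark i₀) :=
  Measure.isProbabilityMeasure_map
    (measurable_pi_lambda _ fun l => measurable_familyTree l i₀).aemeasurable

/-- The law of the `n`-type branching process of a non-negative matrix `B`: marks and types are the
same, and a particle of type `i` has a Poisson number of children of type `j` with mean
`ℓ * B i j`. -/
def nTypeBPLaw {n : ℕ} (ℓ : ℝ) (B : Matrix (Fin n) (Fin n) ℝ) (i₀ : Fin n) :
    Measure ((l : ℕ) → LabelledTree (Fin n) l) :=
  markedBPLaw (fun i j => (ℓ * B i j).toNNReal) PMF.pure i₀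

/-- `P` sorts the rows of `A` into classes `P ⁻¹' {1}, …, P ⁻¹' {K}` (some of which may be empty)
such that rows in the same class are identical. -/
def IsCanonicalPartition {n K : ℕ} (A : Matrix (Fin n) (Fin n) ℝ) (P : Fin n → Fin K) : Prop :=
  ∀ i j, P i = P j → ∀ m, A i m = A j m

open Classical in
/-- The proxy adjacency matrix: `1` if all edges between the two classes are present,
else `0`. -/
def proxy {n K : ℕ} (A : Matrix (Fin n) (Fin n) ℝ) (P : Fin n → Fin K) :
    Matrix (Fin K) (Fin K) ℝ :=
  fun s t => if ∀ i m, P i = s → P m = t → A i m = 1 then 1 else 0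

/-- The total weight of the class `t`. -/
def classWeight {n K : ℕ} (a : Fin n → ℝ) (P : Fin n → Fin K) (t : Fin K) : ℝ :=
  ∑ m with P m = t, a m

/-- The weight of the mark `m` for a particle of type `t`. -/
def markWeight {n K : ℕ} (a : Fin n → ℝ) (P : Fin n → Fin K) (t : Fin K) (m : Fin n) : ℝ≥0∞ :=
  if P m = t then ENNReal.ofReal (a m) else 0

theorem tsum_markWeight_ne_top {n K : ℕ} (a : Fin n → ℝ) (P : Fin n → Fin K) (t : Fin K) :
    ∑' m, markWeight a P t m ≠ ∞ := by
  rw [tsum_fintype, ENNReal.sum_ne_top]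
  intro m _
  unfold markWeight
  split_ifs <;> simp

open Classical in
/-- The law of the mark of a type-`t` particle: `m` in the class `t` is chosen with probability
`a m / classWeight a P t`. If the class has weight `0`, there are no particles of type `t`, and the
value is arbitrary. -/
def markLaw {n K : ℕ} (a : Fin n → ℝ) (P : Fin n → Fin K) (i₀ : Fin n) (t : Fin K) :
    PMF (Fin n) :=
  if h : ∑' m, markWeight a P t m = 0 then PMF.pure i₀
  else PMF.normalize (markWeight a P t) h (tsum_markWeight_ne_top a P t)

/-- The law of the marked branching process whose types are the classes of `P`. -/
def classBPLaw {n K : ℕ} (ℓ : ℝ) (A : Matrix (Fin n) (Fin n) ℝ) (a : Fin n → ℝ)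
    (P : Fin n → Fin K) (i₀ : Fin n) : Measure ((l : ℕ) → LabelledTree (Fin n) l) :=
  markedBPLaw (fun i t => (ℓ * a i * proxy A P (P i) t * classWeight a P t).toNNReal)
    (markLaw a P i₀) i₀

end RankOneKL

end

namespace RankOneKL

/-! The two claims have separate proofs. The row count is `card_le_rowBound`, by strong induction on
the rank r of a matrix with m distinct rows. If any two rows differ in at least 29/100 of the
columns, their sign vectors form a spherical code in dimension at most r + 1, and a volume argument
gives O(√2 ^ r) rows (`card_le_of_hammingDist_ge`). Otherwise let D be the set of columns separating
a closest pair of rows, and T its complement. Call two rows indexed by T twins if they agree on T;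
by minimality of |D| they then differ on all of D, so no three rows are mutually twins. A row
difference vanishing on T lowers the rank of the T × T submatrix, and by 2 if both rows are indexed
by T (`rank_submatrix_add_two_mul_finrank_le`). Without twins the rank drops by 1 while more than
71/100 of the rows survive, and 71/100 * √2 > 1. With two independent twin differences the rank
drops by 4 and the rows on T at most halve in number. If all twin differences are ± one vector, the
rank drops by 2, and the Plotkin bound shows that D hardly exceeds the set of rows without a twin
(`card_le_card_singletons_add_four`), so m at most doubles up to an additive 4.

For the processes, Poisson thinning says that a particle with mark i has independent Poisson numbers
of children with mark m, of mean ∑ t, rate i t * mark t m. These means determine the law of the tree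
(`markedBPLaw_eq`), by induction on the height with generating functionals of random multisets. In
both processes they equal ℓ a_i A_im a_m, since A is constant on blocks of the partition. -/

/-! ### Rank loss when passing to submatrices. -/

/-- Restriction of coordinates maps the column space of `M` onto that of the submatrix and kills
`L`; rank-nullity does the rest. -/
theorem rank_submatrix_rows_add_finrank_le {V U T : Type*} [Fintype V] [Fintype U] [Fintype T]
    (M : Matrix V U ℝ) (e : T → V) (L : Submodule ℝ (V → ℝ))
    (hL : L ≤ LinearMap.range M.mulVecLin) (h0 : ∀ x ∈ L, ∀ t, x (e t) = 0) :
    (M.submatrix e id).rank + Module.finrank ℝ L ≤ M.rank := by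
  set W := LinearMap.range M.mulVecLin with hW
  have hrange : LinearMap.range (M.submatrix e id).mulVecLin
      = LinearMap.range ((LinearMap.funLeft ℝ ℝ e).domRestrict W) := by
    ext y
    constructor
    · rintro ⟨x, rfl⟩
      exact ⟨⟨M.mulVecLin x, ⟨x, rfl⟩⟩, by ext t; rfl⟩
    · rintro ⟨⟨_, ⟨x, rfl⟩⟩, rfl⟩
      exact ⟨x, by ext t; rfl⟩
  have hker : Module.finrank ℝ L
      ≤ Module.finrank ℝ (LinearMap.ker ((LinearMap.funLeft ℝ ℝ e).domRestrict W)) := by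
    let g : L →ₗ[ℝ] LinearMap.ker ((LinearMap.funLeft ℝ ℝ e).domRestrict W) :=
      (Submodule.inclusion hL).codRestrict _ fun x => by
        rw [LinearMap.mem_ker]
        ext t
        exact h0 x x.2 t
    refine LinearMap.finrank_le_finrank_of_injective (f := g) fun x y hxy => ?_
    have := congrArg (fun z : LinearMap.ker ((LinearMap.funLeft ℝ ℝ e).domRestrict W) =>
      ((z : W) : V → ℝ)) hxy
    exact Subtype.ext this
  have := LinearMap.finrank_range_add_finrank_ker ((LinearMap.funLeft ℝ ℝ e).domRestrict W)
  unfold Matrix.rank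
  rw [hrange, ← hW]
  omega

/-- `L` is lost twice: once when rows are deleted from `A`, and once when rows are deleted from the
columns selected by `e`, which still span `L`. Symmetry identifies the two intermediate ranks. -/
theorem rank_submatrix_add_two_mul_finrank_le {V T : Type*} [Fintype V] [Fintype T]
    (A : Matrix V V ℝ) (hA : A.IsSymm) (e : T → V) (L : Submodule ℝ (V → ℝ))
    (hL : L ≤ LinearMap.range (A.submatrix id e).mulVecLin) (h0 : ∀ x ∈ L, ∀ t, x (e t) = 0) :
    (A.submatrix e e).rank + 2 * Module.finrank ℝ L ≤ A.rank := by
  classical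
  have hsub : LinearMap.range (A.submatrix id e).mulVecLin ≤ LinearMap.range A.mulVecLin := by
    rintro _ ⟨x, rfl⟩
    refine ⟨fun v => ∑ t, if e t = v then x t else 0, ?_⟩
    ext v
    simp only [Matrix.mulVecLin_apply, Matrix.mulVec, dotProduct, Matrix.submatrix_apply, id,
      Finset.mul_sum]
    rw [Finset.sum_comm]
    simp
  have h1 := rank_submatrix_rows_add_finrank_le A e L (hL.trans hsub) h0
  have h2 := rank_submatrix_rows_add_finrank_le (A.submatrix id e) e L hL h0
  have h3 : (A.submatrix e id).rank = (A.submatrix id e).rank := by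
    rw [← Matrix.rank_transpose, Matrix.transpose_submatrix, hA.eq]
  rw [Matrix.submatrix_submatrix] at h2
  simp only [Function.id_comp, Function.comp_id] at h2
  omega

/-! ### Plotkin bound, by double counting. -/

/-- The Plotkin bound. -/
theorem plotkin_bound {ι V : Type*} [DecidableEq ι] (x : ι → V → ℝ)
    (hx : ∀ i v, x i v = 0 ∨ x i v = 1)
    (S : Finset ι) (N : Finset V) (t : ℕ)
    (h : ∀ i ∈ S, ∀ j ∈ S, i ≠ j → t ≤ (N.filter fun v => x i v ≠ x j v).card) :
    2 * (((S.card : ℝ) - 1) * t) ≤ N.card * S.card := by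
  rcases S.eq_empty_or_nonempty with rfl | hS
  · simp
  have hpos : (0 : ℝ) < S.card := by exact_mod_cast hS.card_pos
  -- For p, q in {0, 1}, the indicator of p ≠ q is p + q - 2pq.
  have hcard : ∀ i j, ((N.filter fun v => x i v ≠ x j v).card : ℝ)
      = ∑ v ∈ N, (x i v + x j v - 2 * x i v * x j v) := by
    intro i j
    rw [Finset.card_filter, Nat.cast_sum]
    refine Finset.sum_congr rfl fun v _ => ?_
    rcases hx i v with h1 | h1 <;> rcases hx j v with h2 | h2 <;> rw [h1, h2] <;> norm_num
  have hlow : (S.card : ℝ) * (S.card - 1) * t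
      ≤ ∑ i ∈ S, ∑ j ∈ S, ((N.filter fun v => x i v ≠ x j v).card : ℝ) := by
    have : ∀ i ∈ S, ((S.card : ℝ) - 1) * t
        ≤ ∑ j ∈ S, ((N.filter fun v => x i v ≠ x j v).card : ℝ) := by
      intro i hi
      rw [← Finset.add_sum_erase S _ hi]
      have h2 : ∑ j ∈ S.erase i, (t : ℝ)
          ≤ ∑ j ∈ S.erase i, ((N.filter fun v => x i v ≠ x j v).card : ℝ) := by
        refine Finset.sum_le_sum fun j hj => ?_
        rw [Finset.mem_erase] at hj
        exact_mod_cast h i hi j hj.2 hj.1.symm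
      rw [Finset.sum_const, Finset.card_erase_of_mem hi, nsmul_eq_mul,
        Nat.cast_sub hS.card_pos, Nat.cast_one] at h2
      have h3 : (0 : ℝ) ≤ ((N.filter fun v => x i v ≠ x i v).card : ℝ) := Nat.cast_nonneg _
      linarith
    calc (S.card : ℝ) * (S.card - 1) * t = ∑ i ∈ S, ((S.card : ℝ) - 1) * t := by
          rw [Finset.sum_const, nsmul_eq_mul]; ring
      _ ≤ _ := Finset.sum_le_sum this
  -- A column with c ones separates 2c(s - c) ≤ s²/2 ordered pairs, where s = |S|.
  have hup : ∑ i ∈ S, ∑ j ∈ S, ((N.filter fun v => x i v ≠ x j v).card : ℝ)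
      ≤ N.card * ((S.card : ℝ) ^ 2 / 2) := by
    have hswap : ∑ i ∈ S, ∑ j ∈ S, ((N.filter fun v => x i v ≠ x j v).card : ℝ)
        = ∑ v ∈ N, (2 * S.card * (∑ i ∈ S, x i v) - 2 * (∑ i ∈ S, x i v) ^ 2) := by
      simp_rw [hcard]
      have : ∀ i ∈ S, ∑ j ∈ S, ∑ v ∈ N, (x i v + x j v - 2 * x i v * x j v)
          = ∑ v ∈ N, ∑ j ∈ S, (x i v + x j v - 2 * x i v * x j v) := fun i _ => Finset.sum_comm
      rw [Finset.sum_congr rfl this, Finset.sum_comm]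
      refine Finset.sum_congr rfl fun v _ => ?_
      simp only [Finset.sum_sub_distrib, Finset.sum_add_distrib, Finset.sum_const, nsmul_eq_mul,
        ← Finset.mul_sum, ← Finset.sum_mul]
      ring
    rw [hswap, ← nsmul_eq_mul, ← Finset.sum_const]
    refine Finset.sum_le_sum fun v _ => ?_
    nlinarith [sq_nonneg ((S.card : ℝ) - 2 * ∑ i ∈ S, x i v)]
  have := hlow.trans hup
  have h5 : (S.card : ℝ) * (2 * (((S.card : ℝ) - 1) * t)) ≤ S.card * (N.card * S.card) := by
    nlinarith
  exact le_of_mul_le_mul_left h5 hpos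

/-! ### Spherical codes, by volumes of caps. -/

theorem inv_sqrt_two_sq : ((√2 : ℝ)⁻¹) ^ 2 = 1 / 2 := by
  rw [inv_pow, Real.sq_sqrt (by norm_num)]; norm_num

/-- The spherical cap around the unit vector `x`, filled up to a convex body. -/
def solidCap {E : Type*} [NormedAddCommGroup E] [InnerProductSpace ℝ E] (x : E) : Set E :=
  {z | ‖z‖ ≤ 1 ∧ 67 / 100 ≤ inner ℝ x z}

section Cap

variable {E : Type*} [NormedAddCommGroup E] [InnerProductSpace ℝ E]

/-- A linear map which multiplies `x` by `3 / 200` and its orthogonal complement by `1 / √2`. -/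
noncomputable def squeeze (x : E) : E →ₗ[ℝ] E :=
  (√2 : ℝ)⁻¹ • LinearMap.transvection ((innerSL ℝ x).toLinearMap : E →ₗ[ℝ] ℝ)
    ((3 / 200 * √2 - 1 : ℝ) • x)

theorem det_squeeze [FiniteDimensional ℝ E] {x : E} (hx : ‖x‖ = 1) :
    LinearMap.det (squeeze x) = (√2 : ℝ)⁻¹ ^ Module.finrank ℝ E * (3 / 200 * √2) := by
  rw [squeeze, LinearMap.det_smul, LinearMap.transvection.det]
  simp [hx]

theorem squeeze_apply (x z : E) :
    squeeze x z = (√2 : ℝ)⁻¹ • (z - inner ℝ x z • x) + (3 / 200 * inner ℝ x z : ℝ) • x := by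
  have h : (√2 : ℝ)⁻¹ * √2 = 1 := by simp
  simp only [squeeze, LinearMap.smul_apply, LinearMap.transvection.apply,
    ContinuousLinearMap.coe_coe, innerSL_apply_apply, smul_add, smul_sub, smul_smul]
  have : (√2 : ℝ)⁻¹ * (inner ℝ x z * (3 / 200 * √2 - 1))
      = 3 / 200 * inner ℝ x z - (√2 : ℝ)⁻¹ * inner ℝ x z := by
    linear_combination (3 / 200 * inner ℝ x z) * h
  rw [this, sub_smul]
  abel

/-- The ellipsoid has heights along `x` between 137/200 - 3/200 = 67/100 and 137/200 + 3/200 = 7/10.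
As (7/10)² < 1/2, a radius 1/√2 orthogonally to `x` still fits into the unit ball. -/
theorem image_squeeze_subset {x : E} (hx : ‖x‖ = 1) :
    (fun z => (137 / 200 : ℝ) • x + z) '' (squeeze x '' Metric.closedBall 0 1) ⊆ solidCap x := by
  rintro _ ⟨_, ⟨z, hz, rfl⟩, rfl⟩
  rw [mem_closedBall_zero_iff] at hz
  set τ : ℝ := inner ℝ x z with hτ
  set y : E := z - τ • x with hy
  have hxx : inner ℝ x x = (1 : ℝ) := by rw [real_inner_self_eq_norm_sq, hx]; norm_num
  have hxy : inner ℝ x y = (0 : ℝ) := by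
    rw [hy, inner_sub_right, real_inner_smul_right, hxx, ← hτ]; ring
  have hτ1 : |τ| ≤ 1 := by
    have := abs_real_inner_le_norm x z
    rw [hx, one_mul] at this
    exact this.trans hz
  have hyz : ‖y‖ ^ 2 ≤ 1 := by
    have h1 : ‖z‖ ^ 2 = ‖y‖ ^ 2 + τ ^ 2 := by
      have : z = y + τ • x := by rw [hy]; abel
      rw [this, norm_add_sq_real, real_inner_smul_right, real_inner_comm, hxy, norm_smul, hx]
      simp
    nlinarith [norm_nonneg z, sq_nonneg τ]
  have hform : (137 / 200 : ℝ) • x + squeeze x z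
      = (√2 : ℝ)⁻¹ • y + (137 / 200 + 3 / 200 * τ) • x := by
    rw [squeeze_apply, add_smul]
    abel
  rw [abs_le] at hτ1
  constructor
  · simp only [hform]
    have h2 : ‖(√2 : ℝ)⁻¹ • y + (137 / 200 + 3 / 200 * τ) • x‖ ^ 2
        = 1 / 2 * ‖y‖ ^ 2 + (137 / 200 + 3 / 200 * τ) ^ 2 := by
      rw [norm_add_sq_real, real_inner_smul_right, real_inner_smul_left, real_inner_comm, hxy,
        norm_smul, norm_smul, hx, mul_pow, mul_pow, Real.norm_eq_abs, sq_abs, inv_sqrt_two_sq,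
        Real.norm_eq_abs, sq_abs]
      ring
    have h3 : ‖(√2 : ℝ)⁻¹ • y + (137 / 200 + 3 / 200 * τ) • x‖ ^ 2 ≤ 1 := by
      rw [h2]; nlinarith
    exact (sq_le_one_iff₀ (norm_nonneg _)).1 h3
  · simp only [hform]
    rw [inner_add_right, real_inner_smul_right, real_inner_smul_right, hxy, hxx]
    linarith [hτ1.1]

theorem measurableSet_solidCap [MeasurableSpace E] [BorelSpace E] (x : E) :
    MeasurableSet (solidCap x) := by
  have h1 : IsClosed {z : E | ‖z‖ ≤ 1} := isClosed_le continuous_norm continuous_const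
  have h2 : IsClosed {z : E | (67 / 100 : ℝ) ≤ inner ℝ x z} :=
    isClosed_le continuous_const (by fun_prop)
  exact (h1.inter h2).measurableSet

/-- The caps overlap boundedly, in any dimension, because (67/100)² > 42/100: the sum of the s
centres has inner product at least 67/100 * s with `z`, but squared norm at most s(58/100 + 42/100 *
s). -/
theorem card_solidCap_le {ι : Type*} (x : ι → E)
    (hx : ∀ i, ‖x i‖ = 1) (hxx : ∀ i j, i ≠ j → inner ℝ (x i) (x j) ≤ (42 / 100 : ℝ))
    (S : Finset ι) (z : E) (hz : ∀ i ∈ S, z ∈ solidCap (x i)) : (S.card : ℝ) ≤ 35 := by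
  classical
  rcases S.eq_empty_or_nonempty with rfl | ⟨i₀, hi₀⟩
  · norm_num
  have hz1 : ‖z‖ ≤ 1 := (hz i₀ hi₀).1
  have h1 : (S.card : ℝ) * (67 / 100) ≤ inner ℝ (∑ i ∈ S, x i) z := by
    rw [sum_inner, ← nsmul_eq_mul, ← Finset.sum_const]
    exact Finset.sum_le_sum fun i hi => (hz i hi).2
  have h2 : inner ℝ (∑ i ∈ S, x i) z ≤ ‖∑ i ∈ S, x i‖ := by
    have := real_inner_le_norm (∑ i ∈ S, x i) z
    nlinarith [norm_nonneg (∑ i ∈ S, x i)]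
  have h3 : ‖∑ i ∈ S, x i‖ ^ 2 ≤ S.card * (58 / 100 + 42 / 100 * S.card) := by
    rw [← real_inner_self_eq_norm_sq, sum_inner, ← nsmul_eq_mul, ← Finset.sum_const]
    refine Finset.sum_le_sum fun i hi => ?_
    rw [inner_sum]
    calc ∑ j ∈ S, inner ℝ (x i) (x j)
        ≤ ∑ j ∈ S, ((if i = j then 58 / 100 else 0) + 42 / 100 : ℝ) := by
          refine Finset.sum_le_sum fun j _ => ?_
          split_ifs with h
          · rw [← h, real_inner_self_eq_norm_sq, hx]; norm_num
          · simpa using hxx i j h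
      _ = _ := by
          rw [Finset.sum_add_distrib, Finset.sum_ite_eq, if_pos hi, Finset.sum_const, nsmul_eq_mul]
          ring
  have hpos : (0 : ℝ) < S.card := by exact_mod_cast Finset.card_pos.2 ⟨i₀, hi₀⟩
  have h4 : ((S.card : ℝ) * (67 / 100)) ^ 2 ≤ S.card * (58 / 100 + 42 / 100 * S.card) :=
    (pow_le_pow_left₀ (by positivity) (h1.trans h2) 2).trans h3
  have h5 : (S.card : ℝ) * (S.card * (67 / 100) ^ 2) ≤ S.card * (58 / 100 + 42 / 100 * S.card) := by
    linarith
  have h6 := le_of_mul_le_mul_left h5 hpos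
  linarith

/-- Rankin's bound for spherical codes, for one particular angle. -/
theorem spherical_code_bound [FiniteDimensional ℝ E] {ι : Type*} [Fintype ι] (x : ι → E)
    (hx : ∀ i, ‖x i‖ = 1) (hxx : ∀ i j, i ≠ j → inner ℝ (x i) (x j) ≤ (42 / 100 : ℝ)) :
    (Fintype.card ι : ℝ) * 3 * √2 ≤ 7000 * √2 ^ Module.finrank ℝ E := by
  classical
  borelize E
  let μ : Measure E := Measure.addHaar
  set B : Set E := Metric.closedBall 0 1 with hB
  have hB0 : μ B ≠ 0 := (Metric.measure_closedBall_pos μ 0 one_pos).ne'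
  have hBt : μ B ≠ ∞ := measure_closedBall_lt_top.ne
  set δ : ℝ := (√2 : ℝ)⁻¹ ^ Module.finrank ℝ E * (3 / 200 * √2) with hδ
  have hδ0 : 0 < δ := by positivity
  have hcap : ∀ i, ENNReal.ofReal δ * μ B ≤ μ (solidCap (x i)) := by
    intro i
    refine le_trans (le_of_eq ?_) (measure_mono (image_squeeze_subset (hx i)))
    rw [Set.image_add_left, measure_preimage_add, Measure.addHaar_image_linearMap,
      det_squeeze (hx i), abs_of_pos hδ0]
  -- Integrate the number of caps that contain a given point of the ball.
  have hsum : ∑ i, μ (solidCap (x i)) ≤ 35 * μ B := by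
    calc ∑ i, μ (solidCap (x i))
        = ∑ i, ∫⁻ z, (solidCap (x i)).indicator 1 z ∂μ := by
          simp_rw [lintegral_indicator_one (measurableSet_solidCap _)]
      _ = ∫⁻ z, ∑ i, (solidCap (x i)).indicator 1 z ∂μ := by
          rw [lintegral_finsetSum]
          exact fun i _ => measurable_one.indicator (measurableSet_solidCap _)
      _ ≤ ∫⁻ z, B.indicator (fun _ => 35) z ∂μ := by
          refine lintegral_mono fun z => ?_
          by_cases hz : z ∈ B
          · rw [Set.indicator_of_mem hz]
            simp only [Set.indicator_apply, Pi.one_apply]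
            rw [Finset.sum_boole]
            have := card_solidCap_le x hx hxx (Finset.univ.filter fun i => z ∈ solidCap (x i)) z
              (by simp)
            exact_mod_cast this
          · rw [Set.indicator_of_notMem hz]
            refine le_of_eq (Finset.sum_eq_zero fun i _ => ?_)
            rw [Set.indicator_of_notMem]
            exact fun h => hz (by simpa [hB] using h.1)
      _ = 35 * μ B := by
          rw [lintegral_indicator Metric.isClosed_closedBall.measurableSet]
          simp [hB]
  have hmul : (Fintype.card ι : ℝ≥0∞) * ENNReal.ofReal δ * μ B ≤ 35 * μ B := by
    refine le_trans ?_ hsum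
    rw [mul_assoc, ← nsmul_eq_mul, ← Finset.card_univ, ← Finset.sum_const]
    exact Finset.sum_le_sum fun i _ => hcap i
  rw [ENNReal.mul_le_mul_iff_left hB0 hBt] at hmul
  have hreal : (Fintype.card ι : ℝ) * δ ≤ 35 := by
    have := ENNReal.toReal_mono (by norm_num) hmul
    simpa [ENNReal.toReal_ofReal hδ0.le] using this
  have hp : (0 : ℝ) < √2 ^ Module.finrank ℝ E := by positivity
  have hδ' : δ * √2 ^ Module.finrank ℝ E = 3 / 200 * √2 := by
    rw [hδ, inv_pow]
    field_simp
  -- Clearing the denominator of 3/200 turns 35 into 7000.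
  have := mul_le_mul_of_nonneg_right hreal hp.le
  rw [mul_assoc, hδ'] at this
  linarith

end Cap

/-! ### From binary codes to spherical codes. -/

/-- A binary code of small rank in which any two words are far apart is small. -/
theorem card_le_of_hammingDist_ge {ι V : Type*} [Fintype ι] [Fintype V] [Nonempty V]
    (M : Matrix ι V ℝ) (hM : ∀ i v, M i v = 0 ∨ M i v = 1)
    (hd : ∀ i j, i ≠ j → (29 / 100 : ℝ) * Fintype.card V ≤ hammingDist (M i) (M j)) :
    (Fintype.card ι : ℝ) ≤ 2400 * √2 ^ M.rank := by
  classical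
  set n : ℝ := (Fintype.card V : ℝ) with hn
  have hn0 : 0 < n := by rw [hn]; exact_mod_cast Fintype.card_pos
  -- Normalised sign vectors: relative distance 29/100 becomes inner product 1 - 2 * 29/100 =
  -- 42/100.
  let u : ι → EuclideanSpace ℝ V := fun i => WithLp.toLp 2 fun v => (√n)⁻¹ * (1 - 2 * M i v)
  have hin : ∀ i j, inner ℝ (u i) (u j) = (1 - 2 * (hammingDist (M i) (M j) : ℝ) / n) := by
    intro i j
    have h1 : ∀ v, (√n)⁻¹ * (1 - 2 * M j v) * ((√n)⁻¹ * (1 - 2 * M i v))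
        = n⁻¹ * (1 - 2 * if M i v ≠ M j v then 1 else 0) := by
      intro v
      have : (√n)⁻¹ * (√n)⁻¹ = n⁻¹ := by rw [← mul_inv, Real.mul_self_sqrt hn0.le]
      rw [← this]
      rcases hM i v with h1 | h1 <;> rcases hM j v with h2 | h2 <;> rw [h1, h2] <;> norm_num
    have h2 : (hammingDist (M i) (M j) : ℝ) = ∑ v, if M i v ≠ M j v then (1 : ℝ) else 0 := by
      rw [hammingDist, Finset.card_filter]; push_cast; rfl
    rw [h2]
    simp only [u, PiLp.inner_apply, RCLike.inner_apply, conj_trivial, h1]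
    rw [← Finset.mul_sum, Finset.sum_sub_distrib, ← Finset.mul_sum]
    simp only [Finset.sum_const, Finset.card_univ, nsmul_eq_mul, mul_one, ← hn]
    field_simp
  set W := Submodule.span ℝ (Set.range u) with hW
  let x : ι → W := fun i => ⟨u i, Submodule.subset_span ⟨i, rfl⟩⟩
  have hx : ∀ i, ‖x i‖ = 1 := by
    intro i
    have : ‖u i‖ ^ 2 = 1 := by
      rw [← real_inner_self_eq_norm_sq, hin]; simp
    exact (pow_eq_one_iff_of_nonneg (norm_nonneg _) two_ne_zero).1 this
  have hxx : ∀ i j, i ≠ j → inner ℝ (x i) (x j) ≤ (42 / 100 : ℝ) := by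
    intro i j hij
    change inner ℝ (u i) (u j) ≤ _
    rw [hin]
    have : (29 / 100 : ℝ) ≤ hammingDist (M i) (M j) / n := by
      rw [le_div_iff₀ hn0]; exact hd i j hij
    rw [mul_div_assoc]; linarith
  have hb := spherical_code_bound x hx hxx
  -- The sign vectors lie in the row space enlarged by the constant vector. The extra dimension
  -- costs a factor √2, which cancels the one in `spherical_code_bound`; then 7000/3 ≤ 2400.
  have hdim : Module.finrank ℝ W ≤ M.rank + 1 := by
    let φ : (V → ℝ) ≃ₗ[ℝ] EuclideanSpace ℝ V := (WithLp.linearEquiv 2 ℝ (V → ℝ)).symm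
    let R : Submodule ℝ (V → ℝ) := Submodule.span ℝ (Set.range M.row)
    let O : Submodule ℝ (V → ℝ) := Submodule.span ℝ {fun _ => 1}
    have hle : W ≤ (R ⊔ O).map φ.toLinearMap := by
      rw [hW, Submodule.span_le]
      rintro _ ⟨i, rfl⟩
      refine ⟨(√n)⁻¹ • ((-2 : ℝ) • M.row i + fun _ => 1), ?_, ?_⟩
      · refine Submodule.smul_mem _ _ (Submodule.add_mem_sup (Submodule.smul_mem _ _ ?_) ?_)
        · exact Submodule.subset_span ⟨i, rfl⟩
        · exact Submodule.subset_span rfl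
      · ext v
        simp [φ, u, Matrix.row]
        ring
    have h1 := Submodule.finrank_mono hle
    have h2 : Module.finrank ℝ ((R ⊔ O).map φ.toLinearMap) ≤ Module.finrank ℝ ↥(R ⊔ O) :=
      Submodule.finrank_map_le _ _
    have h3 := Submodule.finrank_add_le_finrank_add_finrank R O
    have h4 : Module.finrank ℝ O ≤ 1 := by
      refine (finrank_span_le_card _).trans ?_
      simp
    have h5 : M.rank = Module.finrank ℝ R := M.rank_eq_finrank_span_row
    omega
  have hs1 : (1 : ℝ) ≤ √2 := by
    rw [Real.one_le_sqrt]; norm_num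
  have hpow := pow_le_pow_right₀ hs1 hdim
  rw [pow_succ] at hpow
  have h0 : (0 : ℝ) < √2 := by positivity
  have hp : (0 : ℝ) < √2 ^ M.rank := by positivity
  have : (Fintype.card ι : ℝ) * 3 * √2 ≤ 7000 * √2 ^ M.rank * √2 := by linarith
  have := le_of_mul_le_mul_right this h0
  linarith

/-! ### Principal submatrices and twin rows. -/

theorem rank_submatrix_self_le {V T : Type*} [Fintype V] [Fintype T]
    (A : Matrix V V ℝ) (hA : A.IsSymm) (e : T → V) : (A.submatrix e e).rank ≤ A.rank := by
  have := rank_submatrix_add_two_mul_finrank_le A hA e ⊥ bot_le (by simp)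
  omega

/-- Here `L` need not be spanned by the columns in `e`, so only one loss is guaranteed. This serves
the case without twins, where a row of the closest pair may be indexed by `D`. -/
theorem rank_submatrix_self_add_finrank_le {V T : Type*} [Fintype V] [Fintype T]
    (A : Matrix V V ℝ) (e : T → V) (L : Submodule ℝ (V → ℝ))
    (hL : L ≤ LinearMap.range A.mulVecLin) (h0 : ∀ x ∈ L, ∀ t, x (e t) = 0) :
    (A.submatrix e e).rank + Module.finrank ℝ L ≤ A.rank := by
  have h1 := rank_submatrix_rows_add_finrank_le A e L hL h0
  have h2 := rank_submatrix_rows_add_finrank_le (A.submatrix e id).transpose e ⊥ bot_le (by simp)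
  rw [Matrix.rank_transpose, ← Matrix.rank_transpose] at h2
  have h3 : ((A.submatrix e id).transpose.submatrix e id).transpose = A.submatrix e e := rfl
  rw [h3] at h2
  omega

theorem sub_row_mem_range {V T : Type*} [Fintype V] [Fintype T] (A : Matrix V V ℝ)
    (hA : A.IsSymm) (e : T → V) (a b : T) :
    A (e a) - A (e b) ∈ LinearMap.range (A.submatrix id e).mulVecLin := by
  classical
  refine ⟨Pi.single a 1 - Pi.single b 1, ?_⟩
  ext v
  simp [Matrix.mulVec_sub, Matrix.col, hA.apply]

/-- The row `u` of `A`, restricted to the columns in `T`. -/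
def restrictRow {V : Type*} (A : Matrix V V ℝ) (T : Finset V) (u : V) : T → ℝ := fun v => A u v

theorem restrictRow_eq_iff {V : Type*} {A : Matrix V V ℝ} {T : Finset V} {u w : V} :
    restrictRow A T u = restrictRow A T w ↔ ∀ v ∈ T, A u v = A w v := by
  simp [funext_iff, restrictRow]

/-- If the size of symmetric `0`-`1` matrices with distinct rows is bounded in terms of the rank,
then so is the number of distinct rows of a principal submatrix. -/
theorem card_image_restrictRow_le {V : Type*} [Fintype V] [DecidableEq V] {A : Matrix V V ℝ}
    (hA : A.IsSymm) (h01 : ∀ i j, A i j = 0 ∨ A i j = 1) {F : ℕ → ℝ} (hF : Monotone F)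
    {r : ℕ} {T : Finset V} (hT : (A.submatrix (Subtype.val : T → V) (Subtype.val : T → V)).rank ≤ r)
    (hbound : ∀ s ≤ r, ∀ (m : ℕ) (B : Matrix (Fin m) (Fin m) ℝ), B.IsSymm →
      (∀ i j, B i j = 0 ∨ B i j = 1) → Function.Injective B → B.rank = s → (m : ℝ) ≤ F s) :
    ((T.image (restrictRow A T)).card : ℝ) ≤ F r := by
  classical
  set I := T.image (restrictRow A T) with hI
  have hex : ∀ y : I, ∃ u : T, restrictRow A T u = y := by
    rintro ⟨y, hy⟩
    obtain ⟨u, hu, rfl⟩ := Finset.mem_image.1 hy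
    exact ⟨⟨u, hu⟩, rfl⟩
  choose g hg using hex
  let q : Fin I.card ≃ I := I.equivFin.symm
  let B := (A.submatrix (Subtype.val : T → V) (Subtype.val : T → V)).submatrix (g ∘ q) (g ∘ q)
  have hsub : (A.submatrix (Subtype.val : T → V) (Subtype.val : T → V)).IsSymm := hA.submatrix _
  have hBr : B.rank ≤ r := (rank_submatrix_self_le _ hsub _).trans hT
  refine (hbound _ hBr _ B (hsub.submatrix _) (fun i j => h01 _ _) ?_ rfl).trans (hF hBr)
  intro i j hij
  apply q.injective
  apply Subtype.ext
  rw [← hg, ← hg, restrictRow_eq_iff]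
  intro v hv
  let z : I := ⟨restrictRow A T v, Finset.mem_image_of_mem _ hv⟩
  have hz : ∀ w : T, A w v = A w (g z) := by
    intro w
    have := restrictRow_eq_iff.1 (hg z) w w.2
    rw [← hA.apply, ← this, hA.apply]
  rw [hz, hz]
  have := congrFun hij (q.symm z)
  simpa [B] using this

/-- If no three rows of a principal submatrix agree, then twice the number of distinct rows is at
least the number of all rows plus the number of rows without a copy. -/
theorem card_add_card_singletons_le {α β : Type*} [DecidableEq α] [DecidableEq β] (T : Finset α)
    (ρ : α → β) (S : Finset α) (hS : ∀ u, u ∈ S ↔ u ∈ T ∧ ∀ v ∈ T, ρ v = ρ u → v = u)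
    (h3 : ∀ u ∈ T, ∀ v ∈ T, ∀ w ∈ T, ρ u = ρ v → ρ u = ρ w → u = v ∨ u = w ∨ v = w) :
    T.card + S.card ≤ 2 * (T.image ρ).card := by
  classical
  have h1 : T.card = ∑ y ∈ T.image ρ, (T.filter fun u => ρ u = y).card :=
    Finset.card_eq_sum_card_image ρ T
  have h2 : S.card
      = ∑ y ∈ T.image ρ, (S.filter
          fun u => ρ u = y).card := by
    refine Finset.card_eq_sum_card_fiberwise fun u hu => ?_
    exact Finset.mem_coe.2 (Finset.mem_image_of_mem _ ((hS u).1 (Finset.mem_coe.1 hu)).1)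
  rw [h1, h2, ← Finset.sum_add_distrib, mul_comm, ← smul_eq_mul, ← Finset.sum_const]
  -- Fibrewise: a fibre meeting `S` is a singleton and counts 1 + 1; any other has at most two
  -- elements.
  refine Finset.sum_le_sum fun y _ => ?_
  rcases Finset.eq_empty_or_nonempty (S.filter
      fun u => ρ u = y) with h | ⟨u, hu⟩
  · rw [h, Finset.card_empty, add_zero]
    by_contra! hlt
    obtain ⟨a, b, c, ha, hb, hc, hab, hac, hbc⟩ := Finset.two_lt_card_iff.1 hlt
    simp only [Finset.mem_filter] at ha hb hc
    rcases h3 a ha.1 b hb.1 c hc.1 (ha.2.trans hb.2.symm) (ha.2.trans hc.2.symm) with h | h | h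
    · exact hab h
    · exact hac h
    · exact hbc h
  · rw [Finset.mem_filter, hS] at hu
    have hone : (T.filter fun w => ρ w = y).card ≤ 1 := by
      have : (T.filter fun w => ρ w = y) ⊆ {u} := by
        intro w hw
        rw [Finset.mem_filter] at hw
        rw [Finset.mem_singleton]
        exact hu.1.2 w hw.1 (hw.2.trans hu.2.symm)
      exact (Finset.card_le_card this).trans_eq (Finset.card_singleton u)
    have hle : (S.filter fun u => ρ u = y).card
        ≤ (T.filter fun w => ρ w = y).card :=
      Finset.card_le_card (Finset.filter_subset_filter _ fun u hu => ((hS u).1 hu).1)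
    omega

/-- At a point of `D` both vectors are ±1, so a linear relation has coefficients equal up to sign
and forces `y = x` or `y = -x`. -/
theorem finrank_span_pair_of_ne {V : Type*} [Fintype V] {D : Finset V} (hD : D.Nonempty)
    {x y : V → ℝ}
    (hx1 : ∀ v ∈ D, x v = 1 ∨ x v = -1) (hy1 : ∀ v ∈ D, y v = 1 ∨ y v = -1)
    (h1 : y ≠ x) (h2 : y ≠ -x) : Module.finrank ℝ (Submodule.span ℝ {x, y}) = 2 := by
  obtain ⟨v₀, hv₀⟩ := hD
  have hli : LinearIndependent ℝ ![x, y] := by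
    rw [LinearIndependent.pair_iff]
    intro s t hst
    have hval : ∀ v, s * x v + t * y v = 0 := fun v => by simpa using congrFun hst v
    have hst0 : s = t ∨ s = -t := by
      have := hval v₀
      rcases hx1 v₀ hv₀ with h | h <;> rcases hy1 v₀ hv₀ with h' | h' <;> rw [h, h'] at this
      · right; linarith
      · left; linarith
      · left; linarith
      · right; linarith
    by_cases ht : t = 0
    · rcases hst0 with h | h <;> simp [h, ht]
    exfalso
    rcases hst0 with h | h
    · apply h2
      ext v
      have h3 : t * (x v + y v) = 0 := by have := hval v; rw [h] at this; linarith
      have := (mul_eq_zero.1 h3).resolve_left ht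
      simp only [Pi.neg_apply]; linarith
    · apply h1
      ext v
      have h3 : t * (y v - x v) = 0 := by have := hval v; rw [h] at this; linarith
      have := (mul_eq_zero.1 h3).resolve_left ht
      linarith
  have := finrank_span_eq_card hli
  rw [Matrix.range_cons, Matrix.range_cons, Matrix.range_empty, Set.union_empty,
    Set.singleton_union] at this
  simpa using this

/-! ### The induction on the rank. -/

/-- The bound for the number of distinct rows of a symmetric `0`-`1` matrix of rank `r`. -/
noncomputable def rowBound (r : ℕ) : ℝ := 2404 * √2 ^ r - 4

theorem one_le_sqrt_two : (1 : ℝ) ≤ √2 := by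
  rw [Real.one_le_sqrt]; norm_num

theorem rowBound_mono : Monotone rowBound := fun r s h => by
  have := pow_le_pow_right₀ one_le_sqrt_two h
  unfold rowBound
  linarith

/-- The excess 2404 - 2400 pays for the subtracted 4, so the spherical code bound stays below
`rowBound`. -/
theorem sqrt_two_pow_le_rowBound (r : ℕ) : 2400 * √2 ^ r ≤ rowBound r := by
  have := one_le_pow₀ (n := r) one_le_sqrt_two
  unfold rowBound
  linarith

theorem sub_row_eq_one_or {V : Type*} {A : Matrix V V ℝ}
    (h01 : ∀ i j, A i j = 0 ∨ A i j = 1) {u w v : V} (h : A u v ≠ A w v) :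
    (A u - A w) v = 1 ∨ (A u - A w) v = -1 := by
  rw [Pi.sub_apply]
  rcases h01 u v with h1 | h1 <;> rcases h01 w v with h2 | h2 <;> rw [h1, h2] at h ⊢ <;> simp at h ⊢

/-- If all twin pairs outside of `D` differ by `± κ`, then `D` exceeds the number of rows without
a twin by at most `4`. -/
theorem card_le_card_singletons_add_four {V : Type*} [Fintype V] [DecidableEq V]
    {A : Matrix V V ℝ} {D : Finset V} (hA : A.IsSymm) (h01 : ∀ i j, A i j = 0 ∨ A i j = 1)
    (hmin : ∀ i j, i ≠ j → D.card ≤ hammingDist (A i) (A j)) (κ : V → ℝ) (S : Finset V)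
    (hS : ∀ u, u ∈ S ↔ u ∈ Dᶜ ∧ ∀ v ∈ Dᶜ, restrictRow A Dᶜ v = restrictRow A Dᶜ u → v = u)
    (hκ : ∀ v ∈ D, κ v = 1 ∨ κ v = -1)
    (htwin : ∀ u ∈ Dᶜ, ∀ w ∈ Dᶜ, u ≠ w → restrictRow A Dᶜ u = restrictRow A Dᶜ w →
      A u - A w = κ ∨ A u - A w = -κ) :
    D.card ≤ S.card + 4 := by
  have hplot : ∀ ε : ℝ, (ε = 1 ∨ ε = -1) →
      2 * ((((D.filter fun v => κ v = ε).card : ℝ) - 1) * D.card)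
        ≤ (S.card + D.card : ℝ) * (D.filter fun v => κ v = ε).card := by
    intro ε hε
    refine (plotkin_bound A h01 (D.filter fun v => κ v = ε) (S ∪ D) D.card ?_).trans ?_
    · intro i hi j hj hij
      rw [Finset.mem_filter] at hi hj
      refine (hmin i j hij).trans (Finset.card_le_card fun u hu => ?_)
      rw [Finset.mem_filter] at hu ⊢
      refine ⟨?_, hu.2⟩
      by_contra hu'
      -- A column `u` outside `S ∪ D` has a twin `w`, and `A u - A w = ±κ` is constantly 1 or
      -- constantly -1 where `κ = ε`. Hence `A u` is constant there, and by symmetry column `u`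
      -- cannot separate rows `i` and `j`.
      rw [Finset.mem_union, not_or] at hu'
      have huD : u ∈ Dᶜ := Finset.mem_compl.2 hu'.2
      have : ∃ w ∈ Dᶜ, restrictRow A Dᶜ w = restrictRow A Dᶜ u ∧ w ≠ u := by
        by_contra! hno
        exact hu'.1 ((hS u).2 ⟨huD, hno⟩)
      obtain ⟨w, hw, hwu, hne⟩ := this
      have hdiff : (A u - A w) i = (A u - A w) j ∧ ((A u - A w) i = 1 ∨ (A u - A w) i = -1) := by
        rcases htwin u huD w hw hne.symm hwu.symm with h | h <;> rw [h]
        · exact ⟨hi.2.trans hj.2.symm, by rw [hi.2]; exact hε⟩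
        · refine ⟨by rw [Pi.neg_apply, Pi.neg_apply, hi.2, hj.2], ?_⟩
          rw [Pi.neg_apply, hi.2]
          rcases hε with h | h <;> simp [h]
      apply hu.2
      rw [← hA.apply i u, ← hA.apply j u]
      simp only [Pi.sub_apply] at hdiff
      rcases h01 u i with h1 | h1 <;> rcases h01 u j with h2 | h2 <;>
        rcases h01 w i with h3 | h3 <;> rcases h01 w j with h4 | h4 <;>
        rw [h1, h2, h3, h4] at hdiff <;> rw [h1, h2] <;> norm_num at hdiff
    · have : ((S ∪ D).card : ℝ) ≤ S.card + D.card := by exact_mod_cast Finset.card_union_le _ _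
      exact mul_le_mul_of_nonneg_right this (Nat.cast_nonneg _)
  have hsum : ((D.filter fun v => κ v = 1).card : ℝ) + (D.filter fun v => κ v = -1).card
      = D.card := by
    rw [← Finset.card_filter_add_card_filter_not (s := D) (fun v => κ v = 1)]
    push_cast
    congr 2
    refine congrArg _ (Finset.filter_congr fun v hv => ?_)
    rcases hκ v hv with h | h <;> rw [h] <;> norm_num
  have h1 := hplot 1 (Or.inl rfl)
  have h2 := hplot (-1) (Or.inr rfl)
  rcases Nat.eq_zero_or_pos D.card with h0 | h0
  · omega
  have h0' : (0 : ℝ) < D.card := by exact_mod_cast h0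
  -- Add the two Plotkin bounds; the two sign classes of `κ` partition `D`.
  have h3 : (D.card : ℝ) * (2 * (D.card - 2)) ≤ D.card * (S.card + D.card) := by
    rw [← hsum] at *
    nlinarith
  have h4 := le_of_mul_le_mul_left h3 h0'
  have : (D.card : ℝ) ≤ S.card + 4 := by linarith
  exact_mod_cast this

set_option maxHeartbeats 1000000 in
/-- A symmetric `0`-`1` matrix of rank `r` with distinct rows has at most `rowBound r` rows. -/
theorem card_le_rowBound (r : ℕ) : ∀ (m : ℕ) (A : Matrix (Fin m) (Fin m) ℝ), A.IsSymm →
    (∀ i j, A i j = 0 ∨ A i j = 1) → Function.Injective A → A.rank = r →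
    (m : ℝ) ≤ rowBound r := by
  induction r using Nat.strong_induction_on with
  | _ r ih =>
  intro m A hA h01 hinj hr
  have hs1 := one_le_pow₀ (n := r) one_le_sqrt_two
  have hs0 : (0 : ℝ) ≤ √2 := Real.sqrt_nonneg _
  have hs2 : (√2 : ℝ) * √2 = 2 := Real.mul_self_sqrt (by norm_num)
  rcases Nat.eq_zero_or_pos m with hm | hm
  · subst hm
    have := sqrt_two_pow_le_rowBound r
    push_cast
    linarith
  have : Nonempty (Fin m) := ⟨⟨0, hm⟩⟩
  -- The threshold must exceed 1/4, so that 1 - 2 * 29/100 < 1/2 leaves room for the caps, and stay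
  -- below 1 - 1/√2, so that 71/100 * √2 > 1.
  by_cases hfar : ∀ i j, i ≠ j → (29 / 100 : ℝ) * Fintype.card (Fin m) ≤ hammingDist (A i) (A j)
  · have := card_le_of_hammingDist_ge A h01 hfar
    rw [hr, Fintype.card_fin] at this
    exact this.trans (sqrt_two_pow_le_rowBound r)
  push Not at hfar
  obtain ⟨i, j, hij, hclose⟩ := hfar
  -- a pair of rows at minimal distance
  obtain ⟨⟨a, b⟩, hab, hmin⟩ := Finset.exists_min_image
    (Finset.univ.filter fun p : Fin m × Fin m => p.1 ≠ p.2)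
    (fun p => hammingDist (A p.1) (A p.2)) ⟨(i, j), by simpa using hij⟩
  simp only [Finset.mem_filter, Finset.mem_univ, true_and, Prod.forall] at hab hmin
  set D : Finset (Fin m) := Finset.univ.filter fun v => A a v ≠ A b v with hD
  have hDcard : D.card = hammingDist (A a) (A b) := rfl
  have hmin' : ∀ i j, i ≠ j → D.card ≤ hammingDist (A i) (A j) := fun i j h => hmin i j h
  have hDlt : (D.card : ℝ) ≤ 29 / 100 * m := by
    rw [Fintype.card_fin] at hclose
    have : (D.card : ℝ) ≤ hammingDist (A i) (A j) := by exact_mod_cast hmin' i j hij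
    linarith
  have hTcard : (Dᶜ.card : ℝ) = m - D.card := by
    have := Finset.card_add_card_compl D
    rw [Fintype.card_fin] at this
    rw [eq_sub_iff_add_eq', ← Nat.cast_add, this]
  have hDne : D.Nonempty := by
    rw [← Finset.card_pos, hDcard, hammingDist_pos]
    exact fun h => hab (hinj h)
  let e : (Dᶜ : Finset (Fin m)) → Fin m := Subtype.val
  have hIH : ∀ r' < r, (A.submatrix e e).rank ≤ r' →
      ((Dᶜ.image (restrictRow A Dᶜ)).card : ℝ) ≤ rowBound r' := fun r' hr' h =>
    card_image_restrictRow_le hA h01 rowBound_mono h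
      fun s hs => ih s (lt_of_le_of_lt hs hr')
  have hnotD : ∀ v : (Dᶜ : Finset (Fin m)), e v ∉ D := fun v => Finset.mem_compl.1 v.2
  -- rows which agree outside of `D` differ everywhere on `D`
  have hdiff : ∀ u ∈ Dᶜ, ∀ w ∈ Dᶜ, u ≠ w → restrictRow A Dᶜ u = restrictRow A Dᶜ w →
      ∀ v, A u v ≠ A w v ↔ v ∈ D := by
    intro u _ w _ huw hr
    rw [restrictRow_eq_iff] at hr
    have hsub : (Finset.univ.filter fun v => A u v ≠ A w v) ⊆ D := by
      intro v hv
      by_contra hvD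
      exact (Finset.mem_filter.1 hv).2 (hr v (Finset.mem_compl.2 hvD))
    -- Minimality of `|D|` turns the inclusion into an equality.
    have heq := Finset.eq_of_subset_of_card_le hsub (hmin' u w huw)
    intro v
    rw [← heq]; simp
  by_cases htw : ∀ u ∈ Dᶜ, ∀ w ∈ Dᶜ, restrictRow A Dᶜ u = restrictRow A Dᶜ w → u = w
  · -- no twins: the rank drops by one, and no vertices are identified
    have hrank : (A.submatrix e e).rank + 1 ≤ r := by
      have hne : A a - A b ≠ 0 := fun h => hab (hinj (sub_eq_zero.1 h))
      rw [← finrank_span_singleton (K := ℝ) hne, ← hr]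
      refine rank_submatrix_self_add_finrank_le A e _ ?_ ?_
      · rw [Submodule.span_singleton_le_iff_mem]
        exact sub_row_mem_range A hA id a b
      · intro x hx t
        obtain ⟨c, rfl⟩ := Submodule.mem_span_singleton.1 hx
        have : A a (e t) = A b (e t) := by
          by_contra h
          exact hnotD t (Finset.mem_filter.2 ⟨Finset.mem_univ _, h⟩)
        simp [this]
    obtain ⟨r', rfl⟩ : ∃ r', r = r' + 1 := ⟨r - 1, by omega⟩
    have h1 := hIH r' (by omega) (by omega)
    rw [Finset.card_image_of_injOn (fun u hu w hw h => htw u hu w hw h), hTcard] at h1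
    unfold rowBound at h1 ⊢
    rw [pow_succ]
    have hp : (0 : ℝ) < √2 ^ r' := by positivity
    have hs : (1.41 : ℝ) ≤ √2 := Real.le_sqrt_of_sq_le (by norm_num)
    have h2 : (√2 : ℝ) ^ r' ≤ 71 / 100 * (√2 ^ r' * √2) := by nlinarith
    nlinarith
  push Not at htw
  obtain ⟨u₀, hu₀, u₁, hu₁, hu₀₁, hne⟩ := htw
  set κ := A u₀ - A u₁ with hκ
  have hzero : ∀ u ∈ Dᶜ, ∀ w ∈ Dᶜ, u ≠ w → restrictRow A Dᶜ u = restrictRow A Dᶜ w →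
      ∀ v ∉ D, (A u - A w) v = 0 := by
    intro u hu w hw huw h v hv
    have := (hdiff u hu w hw huw h v).not.2 hv
    rw [Pi.sub_apply, sub_eq_zero]
    exact not_not.1 this
  have hone : ∀ u ∈ Dᶜ, ∀ w ∈ Dᶜ, u ≠ w → restrictRow A Dᶜ u = restrictRow A Dᶜ w →
      ∀ v ∈ D, (A u - A w) v = 1 ∨ (A u - A w) v = -1 := fun u hu w hw huw h v hv =>
    sub_row_eq_one_or h01 ((hdiff u hu w hw huw h v).2 hv)
  have hmem : ∀ u ∈ Dᶜ, ∀ w ∈ Dᶜ,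
      A u - A w ∈ LinearMap.range (A.submatrix id e).mulVecLin := fun u hu w hw =>
    sub_row_mem_range A hA e ⟨u, hu⟩ ⟨w, hw⟩
  have h3 : ∀ u ∈ Dᶜ, ∀ v ∈ Dᶜ, ∀ w ∈ Dᶜ, restrictRow A Dᶜ u = restrictRow A Dᶜ v →
      restrictRow A Dᶜ u = restrictRow A Dᶜ w → u = v ∨ u = w ∨ v = w := by
    intro u hu v hv w hw huv huw
    by_contra! hcon
    -- At a point of `D`, three mutual twins would have three pairwise different entries in {0, 1}.
    obtain ⟨x, hx⟩ := hDne
    have e1 := (hdiff u hu v hv hcon.1 huv x).2 hx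
    have e2 := (hdiff u hu w hw hcon.2.1 huw x).2 hx
    have e3 := (hdiff v hv w hw hcon.2.2 (huv.symm.trans huw) x).2 hx
    rcases h01 u x with h1 | h1 <;> rcases h01 v x with h2 | h2 <;>
      rcases h01 w x with h3 | h3 <;> rw [h1, h2] at e1 <;> rw [h1, h3] at e2 <;>
      rw [h2, h3] at e3 <;> first | exact e1 rfl | exact e2 rfl | exact e3 rfl
  set S := Dᶜ.filter fun u => ∀ v ∈ Dᶜ, restrictRow A Dᶜ v = restrictRow A Dᶜ u → v = u with hSdef
  have hS : ∀ u, u ∈ S ↔ u ∈ Dᶜ ∧ ∀ v ∈ Dᶜ, restrictRow A Dᶜ v = restrictRow A Dᶜ u → v = u :=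
    fun u => Finset.mem_filter
  have hcount := card_add_card_singletons_le Dᶜ (restrictRow A Dᶜ) S hS h3
  have hcount' : (Dᶜ.card : ℝ) + S.card ≤ 2 * (Dᶜ.image (restrictRow A Dᶜ)).card := by
    exact_mod_cast hcount
  by_cases hq : ∀ u ∈ Dᶜ, ∀ w ∈ Dᶜ, u ≠ w → restrictRow A Dᶜ u = restrictRow A Dᶜ w →
      A u - A w = κ ∨ A u - A w = -κ
  · have hrank : (A.submatrix e e).rank + 2 * 1 ≤ r := by
      have hκ0 : κ ≠ 0 := fun h => hne (hinj (sub_eq_zero.1 h))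
      rw [← finrank_span_singleton (K := ℝ) hκ0, ← hr]
      refine rank_submatrix_add_two_mul_finrank_le A hA e _ ?_ ?_
      · rw [Submodule.span_singleton_le_iff_mem]
        exact hmem u₀ hu₀ u₁ hu₁
      · intro x hx t
        obtain ⟨c, rfl⟩ := Submodule.mem_span_singleton.1 hx
        rw [Pi.smul_apply, hκ, hzero u₀ hu₀ u₁ hu₁ hne hu₀₁ _ (hnotD t), smul_zero]
    obtain ⟨r', rfl⟩ : ∃ r', r = r' + 2 := ⟨r - 2, by omega⟩
    have h1 := hIH r' (by omega) (by omega)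
    have h4 : (D.card : ℝ) ≤ S.card + 4 := by
      exact_mod_cast card_le_card_singletons_add_four hA h01 hmin' κ S hS
        (hone u₀ hu₀ u₁ hu₁ hne hu₀₁) hq
    -- m = |T| + |D| ≤ |T| + |S| + 4 ≤ 2 * rowBound r' + 4, which is exactly `rowBound (r' + 2)`;
    -- this fixes the constant -4.
    unfold rowBound at h1 ⊢
    rw [pow_add, pow_two, hs2]
    linarith
  · push Not at hq
    obtain ⟨w₀, hw₀, w₁, hw₁, hnew, hw₀₁, hk1, hk2⟩ := hq
    have hrank : (A.submatrix e e).rank + 2 * 2 ≤ r := by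
      have hdim := finrank_span_pair_of_ne hDne (hone u₀ hu₀ u₁ hu₁ hne hu₀₁)
        (hone w₀ hw₀ w₁ hw₁ hnew hw₀₁) hk1 hk2
      have hle := rank_submatrix_add_two_mul_finrank_le A hA e
        (Submodule.span ℝ {A u₀ - A u₁, A w₀ - A w₁}) ?_ ?_
      · rwa [hdim, hr] at hle
      · rw [Submodule.span_le]
        rintro x (rfl | rfl)
        · exact hmem u₀ hu₀ u₁ hu₁
        · exact hmem w₀ hw₀ w₁ hw₁
      · intro x hx t
        obtain ⟨c, d, rfl⟩ := Submodule.mem_span_pair.1 hx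
        rw [Pi.add_apply, Pi.smul_apply, Pi.smul_apply,
          hzero u₀ hu₀ u₁ hu₁ hne hu₀₁ _ (hnotD t),
          hzero w₀ hw₀ w₁ hw₁ hnew hw₀₁ _ (hnotD t)]
        simp
    obtain ⟨r', rfl⟩ : ∃ r', r = r' + 4 := ⟨r - 4, by omega⟩
    have h1 := hIH r' (by omega) (by omega)
    have hS0 : (0 : ℝ) ≤ S.card := Nat.cast_nonneg _
    have hp : (0 : ℝ) < √2 ^ r' := by positivity
    have hs4 : (√2 : ℝ) ^ 4 = 4 := by
      rw [show (4 : ℕ) = 2 * 2 from rfl, pow_mul, pow_two (√2), hs2]; norm_num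
    -- 71/100 * m ≤ |T| ≤ 2 * rowBound r', while √2 ^ 4 = 4 and 2 / (71/100) < 4.
    unfold rowBound at h1 ⊢
    rw [pow_add, hs4]
    nlinarith

/-- The rows of a symmetric `0`-`1` matrix can be sorted into few classes of identical rows. -/
theorem exists_canonicalPartition {n N : ℕ} (A : Matrix (Fin n) (Fin n) ℝ) (hA : A.IsSymm)
    (h01 : ∀ i j, A i j = 0 ∨ A i j = 1) (hN : rowBound A.rank ≤ N) :
    ∃ P : Fin n → Fin N, IsCanonicalPartition A P := by
  classical
  have hcard : (Finset.univ.image (restrictRow A Finset.univ)).card ≤ N := by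
    have := card_image_restrictRow_le (T := Finset.univ) hA h01 rowBound_mono
      (rank_submatrix_self_le A hA _) fun s _ => card_le_rowBound s
    exact_mod_cast this.trans hN
  let q := (Finset.univ.image (restrictRow A Finset.univ)).equivFin
  refine ⟨fun i => Fin.castLE hcard (q ⟨restrictRow A Finset.univ i,
    Finset.mem_image_of_mem _ (Finset.mem_univ i)⟩), fun i j hij m => ?_⟩
  have h1 := q.injective (Fin.castLE_injective hcard hij)
  exact restrictRow_eq_iff.1 (congrArg Subtype.val h1) m (Finset.mem_univ m)

/-! ### Independent labels on words: root and subtrees. -/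

/-- A function on words, given by its value at the empty word and its values at the words
with a given first letter. -/
def consFun {α X : Type*} (x : X) (F : α → List α → X) : List α → X
  | [] => x
  | p :: w => F p w

theorem measurable_consFun {α X : Type*} [MeasurableSpace X] :
    Measurable fun q : X × (α → List α → X) => consFun q.1 q.2 := by
  refine measurable_pi_lambda _ fun w => ?_
  cases w with
  | nil => exact measurable_fst
  | cons p w =>
    exact (measurable_pi_apply w).comp ((measurable_pi_apply p).comp measurable_snd)

theorem prod_list_eq_mul_prod_cons {α β : Type*} [DecidableEq α] [CommMonoid β]
    (s : Finset (List α)) (s' : Finset (α × List α)) (hs' : ∀ q, q ∈ s' ↔ q.1 :: q.2 ∈ s)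
    (f : List α → β) :
    ∏ w ∈ s, f w = (if [] ∈ s then f [] else 1) * ∏ q ∈ s', f (q.1 :: q.2) := by
  classical
  have h1 : ∏ q ∈ s', f (q.1 :: q.2) = ∏ w ∈ s.filter (· ≠ []), f w := by
    refine Finset.prod_bij (fun q _ => q.1 :: q.2) ?_ ?_ ?_ (fun _ _ => rfl)
    · intro q hq
      simpa using (hs' q).1 hq
    · rintro ⟨a, b⟩ _ ⟨c, d⟩ _ h
      simpa using h
    · intro w hw
      rw [Finset.mem_filter] at hw
      cases w with
      | nil => exact absurd rfl hw.2
      | cons p w => exact ⟨(p, w), (hs' _).2 hw.1, rfl⟩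
  have h2 : (if [] ∈ s then f [] else 1) = ∏ w ∈ s.filter (· = []), f w := by
    split_ifs with h0
    · have : s.filter (· = []) = {[]} := by
        ext w
        rw [Finset.mem_filter, Finset.mem_singleton]
        exact ⟨fun h => h.2, fun h => ⟨h ▸ h0, h⟩⟩
      rw [this, Finset.prod_singleton]
    · have : s.filter (· = []) = ∅ := by
        refine Finset.filter_eq_empty_iff.2 fun w hw h => h0 (h ▸ hw)
      rw [this, Finset.prod_empty]
  rw [h1, h2, Finset.prod_filter_mul_prod_filter_not]

/-- Independent labels on all words: the label of the empty word, and independent families of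
labels for the words with a given first letter. -/
theorem map_consFun {α X : Type*} [MeasurableSpace X] (μ : Measure X) [IsProbabilityMeasure μ] :
    (μ.prod (Measure.infinitePi fun _ : α => Measure.infinitePi fun _ : List α => μ)).map
      (fun q => consFun q.1 q.2) = Measure.infinitePi fun _ : List α => μ := by
  classical
  refine Measure.eq_infinitePi _ fun s t ht => ?_
  rw [Measure.map_apply measurable_consFun (.pi s.countable_toSet fun i _ => ht i)]
  let s' : Finset (α × List α) := s.preimage (fun q => q.1 :: q.2) (by
    rintro ⟨a, b⟩ _ ⟨c, d⟩ _ h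
    simpa using h)
  have hs' : ∀ q, q ∈ s' ↔ q.1 :: q.2 ∈ s := fun q => Finset.mem_preimage
  -- A cylinder splits into a condition at the empty word and a cylinder over pairs (first letter,
  -- rest), to which currying applies.
  have hpre : (fun q : X × (α → List α → X) => consFun q.1 q.2) ⁻¹' (Set.pi s t)
      = (if [] ∈ s then t [] else Set.univ) ×ˢ
        ((MeasurableEquiv.curry α (List α) X).symm ⁻¹' Set.pi s' fun q => t (q.1 :: q.2)) := by
    ext ⟨x, F⟩
    simp only [Set.mem_preimage, Set.mem_pi, Finset.mem_coe, Set.mem_prod, hs']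
    constructor
    · intro h
      refine ⟨?_, fun q hq => h _ hq⟩
      split_ifs with h0
      · exact h [] h0
      · trivial
    · rintro ⟨h1, h2⟩ w hw
      cases w with
      | nil => rw [if_pos hw] at h1; exact h1
      | cons p w => exact h2 (p, w) hw
  have hms : MeasurableSet (Set.pi (s' : Set (α × List α)) fun q => t (q.1 :: q.2)) :=
    .pi s'.countable_toSet fun i _ => ht _
  rw [hpre, Measure.prod_prod, ← Measure.map_apply (MeasurableEquiv.measurable _) hms,
    Measure.infinitePi_map_curry_symm (fun _ _ => μ), Measure.infinitePi_pi _ fun i _ => ht _,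
    prod_list_eq_mul_prod_cons s s' hs' fun w => μ (t w)]
  congr 1
  split_ifs <;> simp

theorem integral_infinitePi_finset_prod {ι X : Type*} [MeasurableSpace X] (μ : Measure X)
    [IsProbabilityMeasure μ] (s : Finset ι) (f : ι → X → ℝ) (hf : ∀ i, Measurable (f i)) :
    ∫ F, ∏ i ∈ s, f i (F i) ∂(Measure.infinitePi fun _ : ι => μ) = ∏ i ∈ s, ∫ x, f i x ∂μ := by
  have h1 : ∀ F : ι → X, ∏ i ∈ s, f i (F i)
      = (fun y : s → X => ∏ i : s, f i (y i)) (s.restrict F) := fun F =>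
    (Finset.prod_coe_sort s fun i => f i (F i)).symm
  have hm : Measurable fun y : s → X => ∏ i : s, f i (y i) :=
    Finset.measurable_prod _ fun i _ => (hf i).comp (measurable_pi_apply i)
  calc ∫ F, ∏ i ∈ s, f i (F i) ∂(Measure.infinitePi fun _ : ι => μ)
      = ∫ F, (fun y : s → X => ∏ i : s, f i (y i)) (s.restrict F)
          ∂(Measure.infinitePi fun _ : ι => μ) := integral_congr_ae (ae_of_all _ h1)
    _ = ∫ y, ∏ i : s, f i (y i) ∂(Measure.pi fun _ : s => μ) :=
        integral_restrict_infinitePi (fun _ : ι => μ) hm.aestronglyMeasurable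
    _ = ∏ i ∈ s, ∫ x, f i x ∂μ := by
        rw [integral_fintype_prod_eq_prod (fun i : s => f i),
          Finset.prod_coe_sort s fun i => ∫ x, f i x ∂μ]

/-! ### Generating functions of Poisson variables and random multisets. -/

theorem integral_pow_poissonMeasure (r : ℝ≥0) (y : ℝ) :
    ∫ N, y ^ N ∂(poissonMeasure r) = Real.exp (r * (y - 1)) := by
  rw [integral_poissonMeasure]
  have h : ∀ N : ℕ, (Real.exp (-r) * (r : ℝ) ^ N / (N.factorial : ℝ)) • y ^ N
      = Real.exp (-r) * ((r * y) ^ N / (N.factorial : ℝ)) := by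
    intro N
    rw [smul_eq_mul, mul_pow]; ring
  simp_rw [h]
  have hexp : ∑' N : ℕ, (r * y) ^ N / (N.factorial : ℝ) = Real.exp (r * y) := by
    rw [Real.exp_eq_exp_ℝ, NormedSpace.exp_eq_tsum_div]
  rw [tsum_mul_left, hexp, ← Real.exp_add]
  congr 1; ring

/-- The functional `s ↦ ∏ x ∈ s, z x` on multisets. -/
def multisetProd {E : Type*} (z : E → ℝ) (s : Multiset E) : ℝ := (s.map z).prod

theorem multisetProd_mem_Icc {E : Type*} {z : E → ℝ} (hz : ∀ x, z x ∈ Set.Icc (0 : ℝ) 1)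
    (s : Multiset E) : multisetProd z s ∈ Set.Icc (0 : ℝ) 1 := by
  induction s using Multiset.induction_on with
  | empty => simp [multisetProd]
  | cons a s ih =>
    have h : multisetProd z (a ::ₘ s) = z a * multisetProd z s := by simp [multisetProd]
    rw [h]
    exact ⟨mul_nonneg (hz a).1 ih.1, mul_le_one₀ (hz a).2 ih.1 ih.2⟩

/-- The law of a random multiset in a countable type is determined by its generating
functional. -/
theorem ext_of_integral_multisetProd {E : Type*} [Countable E] [MeasurableSpace (Multiset E)]
    [DiscreteMeasurableSpace (Multiset E)] (μ ν : Measure (Multiset E)) [IsProbabilityMeasure μ]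
    [IsProbabilityMeasure ν]
    (h : ∀ z : E → ℝ, (∀ x, z x ∈ Set.Icc (0 : ℝ) 1) →
      ∫ s, multisetProd z s ∂μ = ∫ s, multisetProd z s ∂ν) : μ = ν := by
  classical
  let _ : TopologicalSpace (Multiset E) := ⊥
  have : DiscreteTopology (Multiset E) := ⟨rfl⟩
  -- The functionals are closed under products, so the algebra they generate is their linear span; a
  -- point-separating algebra determines a probability law on this countable discrete space.
  let S : Submonoid (BoundedContinuousFunction (Multiset E) ℝ) :=
    { carrier := {f | ∃ z : E → ℝ, (∀ x, z x ∈ Set.Icc (0 : ℝ) 1) ∧ ∀ s, f s = multisetProd z s}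
      one_mem' := ⟨fun _ => 1, by simp, by simp [multisetProd]⟩
      mul_mem' := by
        rintro f g ⟨z, hz, hf⟩ ⟨w, hw, hg⟩
        refine ⟨fun x => z x * w x, fun x => ⟨mul_nonneg (hz x).1 (hw x).1,
          mul_le_one₀ (hz x).2 (hw x).1 (hw x).2⟩, fun s => ?_⟩
        simp [hf, hg, multisetProd] }
  let A : StarSubalgebra ℝ (BoundedContinuousFunction (Multiset E) ℝ) :=
    { Algebra.adjoin ℝ (S : Set (BoundedContinuousFunction (Multiset E) ℝ)) with
      star_mem' := by
        intro a ha
        have : star a = a := by ext s; simp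
        rwa [this] }
  have hintegrable : ∀ g : BoundedContinuousFunction (Multiset E) ℝ, ∀ ρ : Measure (Multiset E),
      IsProbabilityMeasure ρ → Integrable g ρ := fun g ρ _ => g.integrable ρ
  refine ext_of_forall_mem_subalgebra_integral_eq_of_polish (𝕜 := ℝ) (A := A) ?_ ?_
  · intro s t hst
    obtain ⟨x, hx⟩ : ∃ x, s.count x ≠ t.count x := by
      by_contra! hcon
      exact hst (Multiset.ext.2 hcon)
    -- The functional of this `z` is (1/2) to the multiplicity of `x`, so it separates multisets
    -- with different multiplicities.
    let z : E → ℝ := fun y => if y = x then 1 / 2 else 1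
    have hz : ∀ y, z y ∈ Set.Icc (0 : ℝ) 1 := by
      intro y; simp only [z]; split_ifs <;> norm_num
    have hval : ∀ s : Multiset E, multisetProd z s = (1 / 2) ^ s.count x := by
      intro s
      induction s using Multiset.induction_on with
      | empty => simp [multisetProd]
      | cons a s ih =>
        have h1 : multisetProd z (a ::ₘ s) = z a * multisetProd z s := by simp [multisetProd]
        rw [h1, ih, Multiset.count_cons]
        by_cases hax : a = x
        · simp [z, hax, pow_succ, mul_comm]
        · simp [z, hax, Ne.symm hax]
    let g : BoundedContinuousFunction (Multiset E) ℝ :=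
      BoundedContinuousFunction.ofNormedAddCommGroup (multisetProd z) continuous_of_discreteTopology
        1 fun s => by
          rw [Real.norm_eq_abs, abs_of_nonneg (multisetProd_mem_Icc hz s).1]
          exact (multisetProd_mem_Icc hz s).2
    refine ⟨g, ⟨BoundedContinuousFunction.toContinuousMapStarₐ ℝ g,
      ⟨g, Algebra.subset_adjoin ⟨z, hz, fun _ => rfl⟩, rfl⟩, rfl⟩, ?_⟩
    change multisetProd z s ≠ multisetProd z t
    rw [hval, hval]
    intro heq
    exact hx (pow_right_injective₀ (by norm_num) (by norm_num) heq)
  · intro g hg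
    have hg' : g ∈ Submodule.span ℝ (S : Set (BoundedContinuousFunction (Multiset E) ℝ)) := by
      have h1 : g ∈ Subalgebra.toSubmodule
          (Algebra.adjoin ℝ (S : Set (BoundedContinuousFunction (Multiset E) ℝ))) := hg
      rwa [Algebra.adjoin_eq_span, Submonoid.closure_eq] at h1
    clear hg
    induction hg' using Submodule.span_induction with
    | mem f hf =>
      obtain ⟨z, hz, hf⟩ := hf
      simp_rw [hf]
      exact h z hz
    | zero => simp
    | add f g _ _ hf hg =>
      simp only [BoundedContinuousFunction.coe_add, Pi.add_apply]
      rw [integral_add (hintegrable f μ inferInstance) (hintegrable g μ inferInstance),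
        integral_add (hintegrable f ν inferInstance) (hintegrable g ν inferInstance)]
      rw [hf, hg]
    | smul c f _ hf =>
      simp only [BoundedContinuousFunction.coe_smul]
      rw [integral_smul, integral_smul, hf]

/-! ### Generating functional of the family tree. -/

section FamilyTree

variable {n K : ℕ}

/-- The law of the noise of all potential particles. -/
noncomputable abbrev envLaw (rate : Fin n → Fin K → ℝ≥0) (mark : Fin K → PMF (Fin n)) :
    Measure (List (Fin K × ℕ) → Noise n K) :=
  Measure.infinitePi fun _ : List (Fin K × ℕ) => noiseLaw rate mark

/-- The children subtrees of the root, in terms of the environments of the children. -/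
def children (l : ℕ) (i : Fin n) (c : Fin n → Fin K → ℕ)
    (F : Fin K × ℕ → List (Fin K × ℕ) → Noise n K) : Multiset (LabelledTree (Fin n) l) :=
  ∑ t : Fin K, ∑ r ∈ Finset.range (c i t),
    ({familyTree l ((F (t, r) []).2 t) (F (t, r))} : Multiset (LabelledTree (Fin n) l))

theorem familyTree_succ_consFun (l : ℕ) (i : Fin n) (x : Noise n K)
    (F : Fin K × ℕ → List (Fin K × ℕ) → Noise n K) :
    familyTree (l + 1) i (consFun x F) = (i, children l i x.1 F) := rfl

/-- The mark stored at the root is used only by the parent, never by the tree itself. This makes the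
mark independent of the tree grown from a prescribed mark. -/
theorem familyTree_consFun_congr (l : ℕ) (i : Fin n) (c : Fin n → Fin K → ℕ) (d d' : Fin K → Fin n)
    (F : Fin K × ℕ → List (Fin K × ℕ) → Noise n K) :
    familyTree l i (consFun (c, d) F) = familyTree l i (consFun (c, d') F) := by
  cases l <;> rfl

/-- The first letters of the words of the children of the root. -/
def childIndices (c : Fin K → ℕ) : Finset (Fin K × ℕ) :=
  (Finset.univ.sigma fun t => Finset.range (c t)).map (Equiv.sigmaEquivProd (Fin K) ℕ).toEmbedding

theorem prod_childIndices (c : Fin K → ℕ) (f : Fin K × ℕ → ℝ) :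
    ∏ p ∈ childIndices c, f p = ∏ t, ∏ r ∈ Finset.range (c t), f (t, r) := by
  rw [childIndices, Finset.prod_map, Finset.prod_sigma]
  rfl

theorem multisetProd_children (l : ℕ) (i : Fin n) (c : Fin n → Fin K → ℕ)
    (F : Fin K × ℕ → List (Fin K × ℕ) → Noise n K) (z : LabelledTree (Fin n) l → ℝ) :
    multisetProd z (children l i c F)
      = ∏ p ∈ childIndices (c i), z (familyTree l ((F p []).2 p.1) (F p)) := by
  rw [prod_childIndices]
  simp only [multisetProd, children, ← Multiset.coe_mapAddMonoidHom, map_sum, Multiset.prod_sum]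
  simp

theorem measurable_familyTree_mark (l : ℕ) (t : Fin K) :
    Measurable fun ω : List (Fin K × ℕ) → Noise n K => familyTree l ((ω []).2 t) ω := by
  have hm : Measurable fun ω : List (Fin K × ℕ) → Noise n K => (ω []).2 t := by fun_prop
  have hj : Measurable fun p : (List (Fin K × ℕ) → Noise n K) × Fin n =>
      familyTree l p.2 p.1 := measurable_from_prod_countable_left (measurable_familyTree l)
  exact hj.comp (measurable_id.prodMk hm)

theorem integrable_of_mem_Icc {Ω : Type*} [MeasurableSpace Ω] {μ : Measure Ω} [IsFiniteMeasure μ]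
    {f : Ω → ℝ} (hf : Measurable f) (h : ∀ ω, f ω ∈ Set.Icc (0 : ℝ) 1) : Integrable f μ :=
  Integrable.of_bound hf.aestronglyMeasurable 1 (ae_of_all _ fun ω => by
    rw [Real.norm_eq_abs, abs_of_nonneg (h ω).1]; exact (h ω).2)

variable (rate : Fin n → Fin K → ℝ≥0) (mark : Fin K → PMF (Fin n))

theorem integral_envLaw {f : (List (Fin K × ℕ) → Noise n K) → ℝ} (hf : Measurable f)
    (h : ∀ ω, f ω ∈ Set.Icc (0 : ℝ) 1) :
    ∫ ω, f ω ∂(envLaw rate mark) = ∫ x, ∫ F, f (consFun x F)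
      ∂(Measure.infinitePi fun _ : Fin K × ℕ => envLaw rate mark) ∂(noiseLaw rate mark) := by
  have hintegrable : Integrable (fun q => f (consFun q.1 q.2)) ((noiseLaw rate mark).prod
      (Measure.infinitePi fun _ : Fin K × ℕ => envLaw rate mark)) :=
    integrable_of_mem_Icc (hf.comp measurable_consFun) fun _ => h _
  rw [← integral_prod _ hintegrable,
    ← integral_map measurable_consFun.aemeasurable hf.aestronglyMeasurable, map_consFun]

/-- The mark of a particle is independent of the family tree given the mark. -/
theorem integral_familyTree_mark (l : ℕ) (t : Fin K) {z : LabelledTree (Fin n) l → ℝ}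
    (hz : ∀ x, z x ∈ Set.Icc (0 : ℝ) 1) :
    ∫ ω, z (familyTree l ((ω []).2 t) ω) ∂(envLaw rate mark)
      = ∑ m, (mark t m).toReal * ∫ ω, z (familyTree l m ω) ∂(envLaw rate mark) := by
  classical
  have hzm : Measurable z := .of_discrete
  set Q := Measure.infinitePi fun _ : Fin K × ℕ => envLaw rate mark with hQ
  -- An arbitrary reference value: the tree ignores it.
  let d₀ : Fin K → Fin n := fun s => (mark s).support_nonempty.some
  let k : Fin n → (Fin n → Fin K → ℕ) → ℝ := fun m c =>
    ∫ F, z (familyTree l m (consFun (c, d₀) F)) ∂Q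
  have hright : ∀ m, ∫ ω, z (familyTree l m ω) ∂(envLaw rate mark)
      = ∫ c, k m c ∂(Measure.pi fun i => Measure.pi fun t => poissonMeasure (rate i t)) := by
    intro m
    rw [integral_envLaw rate mark (f := fun ω => z (familyTree l m ω))
      (hzm.comp (measurable_familyTree l m)) fun _ => hz _]
    have : ∀ x : Noise n K, ∫ F, z (familyTree l m (consFun x F)) ∂Q = k m x.1 := by
      rintro ⟨c, d⟩
      simp only [k, familyTree_consFun_congr l m c d d₀]
    simp_rw [← hQ, this]
    rw [noiseLaw, integral_fun_fst]
    simp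
  have hleft : ∀ x : Noise n K, ∫ F, z (familyTree l (((consFun x F) []).2 t) (consFun x F)) ∂Q
      = ∑ m, k m x.1 * (if x.2 t = m then 1 else 0) := by
    rintro ⟨c, d⟩
    simp only [k, mul_ite, mul_one, mul_zero, Finset.sum_ite_eq, Finset.mem_univ, if_true]
    refine integral_congr_ae (ae_of_all _ fun F => ?_)
    change z (familyTree l (d t) (consFun (c, d) F)) = _
    rw [familyTree_consFun_congr l (d t) c d d₀]
  rw [integral_envLaw rate mark (f := fun ω => z (familyTree l ((ω []).2 t) ω))
    (hzm.comp (measurable_familyTree_mark l t)) fun _ => hz _]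
  simp_rw [← hQ, hleft]
  rw [integral_finsetSum]
  · refine Finset.sum_congr rfl fun m _ => ?_
    rw [noiseLaw, integral_prod_mul (fun c => k m c)
      (fun d : Fin K → Fin n => if d t = m then (1 : ℝ) else 0), hright, mul_comm]
    congr 1
    have h1 : ∫ d, (if d t = m then (1 : ℝ) else 0) ∂(Measure.pi fun t => (mark t).toMeasure)
        = ∫ j, (if j = m then (1 : ℝ) else 0) ∂((mark t).toMeasure) := by
      rw [← (measurePreserving_eval (fun t => (mark t).toMeasure) t).map_eq, integral_map]
      · exact (measurable_pi_apply t).aemeasurable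
      · exact Measurable.of_discrete.aestronglyMeasurable
    rw [h1, PMF.integral_eq_sum]
    simp
  · intro m _
    refine integrable_of_mem_Icc .of_discrete fun x => ?_
    have hk : k m x.1 ∈ Set.Icc (0 : ℝ) 1 := by
      refine ⟨integral_nonneg fun F => (hz _).1, ?_⟩
      calc k m x.1 ≤ ∫ _, (1 : ℝ) ∂Q := integral_mono_of_nonneg (ae_of_all _ fun F => (hz _).1)
            (integrable_const _) (ae_of_all _ fun F => (hz _).2)
        _ = 1 := by simp
    split_ifs
    · simpa using hk
    · simp

theorem sum_toReal_pmf (p : PMF (Fin n)) : ∑ m, (p m).toReal = 1 := by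
  rw [← ENNReal.toReal_sum fun m _ => p.apply_ne_top m, ← tsum_fintype (L := .unconditional _),
    p.tsum_coe, ENNReal.toReal_one]

/-- The generating functional of the family trees of the children of the root. -/
theorem integral_multisetProd_familyTree (l : ℕ) (i : Fin n) {z : LabelledTree (Fin n) l → ℝ}
    (hz : ∀ x, z x ∈ Set.Icc (0 : ℝ) 1) :
    ∫ ω, multisetProd z (familyTree (l + 1) i ω).2 ∂(envLaw rate mark)
      = Real.exp (∑ m, (∑ t, rate i t * (mark t m).toReal)
          * ((∫ ω, z (familyTree l m ω) ∂(envLaw rate mark)) - 1)) := by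
  classical
  have hzm : Measurable z := .of_discrete
  set Q := Measure.infinitePi fun _ : Fin K × ℕ => envLaw rate mark with hQ
  set y : Fin K → ℝ := fun t => ∫ ω, z (familyTree l ((ω []).2 t) ω) ∂(envLaw rate mark) with hy
  have hmeas : Measurable fun ω : List (Fin K × ℕ) → Noise n K =>
      multisetProd z (familyTree (l + 1) i ω).2 := by
    have : Measurable fun T : LabelledTree (Fin n) (l + 1) => multisetProd z T.2 := .of_discrete
    exact this.comp (measurable_familyTree (l + 1) i)
  rw [integral_envLaw rate mark hmeas fun _ => multisetProd_mem_Icc hz _]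
  -- Given the numbers of children, the subtrees are independent, and identically distributed for
  -- each type.
  have hinner : ∀ x : Noise n K,
      ∫ F, multisetProd z (familyTree (l + 1) i (consFun x F)).2 ∂Q = ∏ t, y t ^ x.1 i t := by
    intro x
    simp_rw [familyTree_succ_consFun, multisetProd_children]
    rw [hQ, integral_infinitePi_finset_prod (envLaw rate mark) (childIndices (x.1 i))
      (fun p ω => z (familyTree l ((ω []).2 p.1) ω))
      fun p => hzm.comp (measurable_familyTree_mark l p.1), prod_childIndices]
    simp [hy]
  simp_rw [← hQ, hinner]
  rw [noiseLaw, integral_fun_fst (fun c : Fin n → Fin K → ℕ => ∏ t, y t ^ c i t)]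
  have h2 : ∫ c, ∏ t, y t ^ c i t
        ∂(Measure.pi fun i => Measure.pi fun t => poissonMeasure (rate i t))
      = ∫ c, ∏ t, y t ^ c t ∂(Measure.pi fun t => poissonMeasure (rate i t)) := by
    rw [← (measurePreserving_eval
      (fun i => Measure.pi fun t => poissonMeasure (rate i t)) i).map_eq, integral_map]
    · exact (measurable_pi_apply i).aemeasurable
    · exact Measurable.of_discrete.aestronglyMeasurable
  rw [h2, integral_fintype_prod_eq_prod (fun t N => y t ^ N)]
  simp_rw [integral_pow_poissonMeasure]
  rw [← Real.exp_sum]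
  simp only [probReal_univ, one_smul]
  congr 1
  simp_rw [Finset.sum_mul]
  rw [Finset.sum_comm]
  refine Finset.sum_congr rfl fun t _ => ?_
  -- Since mark probabilities sum to 1, the exponent regroups by marks: this is Poisson thinning.
  have h3 : y t - 1 = ∑ m, (mark t m).toReal *
      ((∫ ω, z (familyTree l m ω) ∂(envLaw rate mark)) - 1) := by
    simp_rw [mul_sub, mul_one]
    rw [Finset.sum_sub_distrib, sum_toReal_pmf, ← integral_familyTree_mark rate mark l t hz]
  rw [h3, Finset.mul_sum]
  exact Finset.sum_congr rfl fun m _ => by ring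

end FamilyTree

/-! ### The means determine the law. -/

/-- The law of the family tree up to generation `l` only depends on the mean numbers of children
with given marks. -/
theorem map_familyTree_eq {n K K' : ℕ} (rate : Fin n → Fin K → ℝ≥0) (mark : Fin K → PMF (Fin n))
    (rate' : Fin n → Fin K' → ℝ≥0) (mark' : Fin K' → PMF (Fin n))
    (h : ∀ i m, ∑ t, (rate i t : ℝ) * (mark t m).toReal
      = ∑ t, (rate' i t : ℝ) * (mark' t m).toReal) (l : ℕ) : ∀ i,
    (envLaw rate mark).map (familyTree l i) = (envLaw rate' mark').map (familyTree l i) := by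
  induction l with
  | zero =>
    intro i
    change (envLaw rate mark).map (fun _ => (i : LabelledTree (Fin n) 0))
      = (envLaw rate' mark').map (fun _ => (i : LabelledTree (Fin n) 0))
    rw [Measure.map_const, Measure.map_const, measure_univ, measure_univ]
  | succ l ih =>
    intro i
    let _ : MeasurableSpace (Multiset (LabelledTree (Fin n) l)) := ⊤
    have : DiscreteMeasurableSpace (Multiset (LabelledTree (Fin n) l)) := ⟨fun _ => trivial⟩
    let branches : LabelledTree (Fin n) (l + 1) → Multiset (LabelledTree (Fin n) l) := Prod.snd
    let root : Multiset (LabelledTree (Fin n) l) → LabelledTree (Fin n) (l + 1) := fun s => (i, s)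
    have hb : Measurable branches := .of_discrete
    have hroot : Measurable root := .of_discrete
    -- The root label is the constant `i`, so the law of the multiset of branches suffices.
    have key : ((envLaw rate mark).map (familyTree (l + 1) i)).map branches
        = ((envLaw rate' mark').map (familyTree (l + 1) i)).map branches := by
      rw [Measure.map_map hb (measurable_familyTree _ i),
        Measure.map_map hb (measurable_familyTree _ i)]
      have hm : Measurable (branches ∘ familyTree (K := K) (l + 1) i) :=
        hb.comp (measurable_familyTree _ i)
      have hm' : Measurable (branches ∘ familyTree (K := K') (l + 1) i) :=
        hb.comp (measurable_familyTree _ i)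
      have := Measure.isProbabilityMeasure_map (μ := envLaw rate mark) hm.aemeasurable
      have := Measure.isProbabilityMeasure_map (μ := envLaw rate' mark') hm'.aemeasurable
      refine ext_of_integral_multisetProd _ _ fun z hz => ?_
      rw [integral_map hm.aemeasurable Measurable.of_discrete.aestronglyMeasurable,
        integral_map hm'.aemeasurable Measurable.of_discrete.aestronglyMeasurable]
      refine (integral_multisetProd_familyTree rate mark l i hz).trans
        (Eq.trans ?_ (integral_multisetProd_familyTree rate' mark' l i hz).symm)
      congr 1
      refine Finset.sum_congr rfl fun m _ => ?_
      have hz' : AEStronglyMeasurable z ((envLaw rate mark).map (familyTree l m)) :=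
        Measurable.of_discrete.aestronglyMeasurable
      rw [h, ← integral_map (measurable_familyTree l m).aemeasurable hz', ih m,
        integral_map (measurable_familyTree l m).aemeasurable
          Measurable.of_discrete.aestronglyMeasurable]
    have hrec : ∀ {K : ℕ}, root ∘ (branches ∘ familyTree (K := K) (l + 1) i)
        = familyTree (l + 1) i := rfl
    have := congrArg (Measure.map root) key
    rwa [Measure.map_map hb (measurable_familyTree _ i),
      Measure.map_map hb (measurable_familyTree _ i),
      Measure.map_map hroot (hb.comp (measurable_familyTree _ i)),
      Measure.map_map hroot (hb.comp (measurable_familyTree _ i)), hrec, hrec] at this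

/-- Forgetting the last generation. -/
def truncate {α : Type} : (l : ℕ) → LabelledTree α (l + 1) → LabelledTree α l
  | 0, T => T.1
  | l + 1, T => (T.1, Multiset.map (truncate l) T.2)

theorem truncate_familyTree {n K : ℕ} (l : ℕ) : ∀ (i : Fin n)
    (ω : List (Fin K × ℕ) → Noise n K),
    truncate l (familyTree (l + 1) i ω) = familyTree l i ω := by
  induction l with
  | zero => exact fun i ω => rfl
  | succ l ih =>
    intro i ω
    refine Prod.ext rfl ?_
    change Multiset.mapAddMonoidHom (truncate l) (∑ t : Fin K, ∑ r ∈ Finset.range ((ω []).1 i t),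
      ({familyTree (l + 1) ((ω [(t, r)]).2 t) fun w => ω ((t, r) :: w)} :
        Multiset (LabelledTree (Fin n) (l + 1)))) = _
    simp only [map_sum, Multiset.coe_mapAddMonoidHom, Multiset.map_singleton, ih]
    rfl

/-- The same `g` works for every `K` and environment, so the joint law of finitely many heights is
the image of the law at the largest one, by one map for both processes. -/
theorem exists_truncation {n : ℕ} {l L : ℕ} (h : l ≤ L) :
    ∃ g : LabelledTree (Fin n) L → LabelledTree (Fin n) l, ∀ (K : ℕ) (i : Fin n)
      (ω : List (Fin K × ℕ) → Noise n K), g (familyTree L i ω) = familyTree l i ω := by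
  induction L, h using Nat.le_induction with
  | base => exact ⟨id, fun _ _ _ => rfl⟩
  | succ L _ ih =>
    obtain ⟨g, hg⟩ := ih
    exact ⟨g ∘ truncate L, fun K i ω => by
      rw [Function.comp_apply, truncate_familyTree, hg]⟩

/-- The law of a marked branching process only depends on the mean numbers of children with given
marks. -/
theorem markedBPLaw_eq {n K K' : ℕ} (rate : Fin n → Fin K → ℝ≥0) (mark : Fin K → PMF (Fin n))
    (rate' : Fin n → Fin K' → ℝ≥0) (mark' : Fin K' → PMF (Fin n))
    (h : ∀ i m, ∑ t, (rate i t : ℝ) * (mark t m).toReal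
      = ∑ t, (rate' i t : ℝ) * (mark' t m).toReal) (i₀ : Fin n) :
    markedBPLaw rate mark i₀ = markedBPLaw rate' mark' i₀ := by
  have hres : ∀ I : Finset ℕ, (markedBPLaw rate mark i₀).map I.restrict
      = (markedBPLaw rate' mark' i₀).map I.restrict := by
    intro I
    choose g hg using fun l : I => exists_truncation (n := n) (Finset.le_sup (f := id) l.2)
    have hG : Measurable fun (T : LabelledTree (Fin n) (I.sup id)) (l : I) => g l T :=
      .of_discrete
    have hlaw : ∀ {K : ℕ} (rate : Fin n → Fin K → ℝ≥0) (mark : Fin K → PMF (Fin n)),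
        (markedBPLaw rate mark i₀).map I.restrict
          = ((envLaw rate mark).map (familyTree (I.sup id) i₀)).map fun T l => g l T := by
      intro K rate mark
      rw [markedBPLaw, Measure.map_map (Finset.measurable_restrict I)
        (measurable_pi_lambda _ fun l => measurable_familyTree l i₀),
        Measure.map_map hG (measurable_familyTree _ i₀)]
      congr 1
      ext ω l
      exact (hg l K i₀ ω).symm
    rw [hlaw, hlaw, map_familyTree_eq rate mark rate' mark' h]
  have hfin : ∀ I : Finset ℕ, IsFiniteMeasure ((markedBPLaw rate mark i₀).map
      (I.restrict (π := fun l => LabelledTree (Fin n) l))) := fun I => inferInstance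
  exact IsProjectiveLimit.unique (P := fun I => (markedBPLaw rate mark i₀).map I.restrict)
    (fun I => rfl) fun I => (hres I).symm

/-! ### Comparison of the class process with the `n`-type process. -/

/-- By symmetry, columns in the same class agree too, so `A` is constant on each block. -/
theorem proxy_eq {n K : ℕ} {A : Matrix (Fin n) (Fin n) ℝ} (hA : A.IsSymm)
    (h01 : ∀ i j, A i j = 0 ∨ A i j = 1) {P : Fin n → Fin K} (hP : IsCanonicalPartition A P)
    (i m : Fin n) : proxy A P (P i) (P m) = A i m := by
  have hcongr : ∀ i' m', P i' = P i → P m' = P m → A i' m' = A i m := by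
    intro i' m' hi hm
    rw [hP i' i hi m', ← hA.apply, hP m' m hm i, hA.apply]
  unfold proxy
  split_ifs with h
  · exact (h i m rfl rfl).symm
  · refine ((h01 i m).resolve_right fun h1 => h fun i' m' hi hm => ?_).symm
    rw [hcongr i' m' hi hm, h1]

theorem tsum_markWeight {n K : ℕ} {a : Fin n → ℝ} (ha : ∀ i, 0 ≤ a i) (P : Fin n → Fin K)
    (t : Fin K) : ∑' m, markWeight a P t m = ENNReal.ofReal (classWeight a P t) := by
  rw [tsum_fintype, classWeight, ENNReal.ofReal_sum_of_nonneg fun m _ => ha m, Finset.sum_filter]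
  rfl

theorem classWeight_nonneg {n K : ℕ} {a : Fin n → ℝ} (ha : ∀ i, 0 ≤ a i) (P : Fin n → Fin K)
    (t : Fin K) : 0 ≤ classWeight a P t := Finset.sum_nonneg fun m _ => ha m

/-- The normalisation cancels. In a class of weight 0 the arbitrary mark law is harmless, as both
sides vanish. -/
theorem classWeight_mul_markLaw {n K : ℕ} {a : Fin n → ℝ} (ha : ∀ i, 0 ≤ a i) (P : Fin n → Fin K)
    (i₀ : Fin n) (t : Fin K) (m : Fin n) :
    classWeight a P t * (markLaw a P i₀ t m).toReal = if P m = t then a m else 0 := by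
  have hw := classWeight_nonneg ha P t
  unfold markLaw
  split_ifs with h h'
  · rw [tsum_markWeight ha, ENNReal.ofReal_eq_zero] at h
    have h0 : classWeight a P t = 0 := le_antisymm h hw
    have hm : a m = 0 := (Finset.sum_eq_zero_iff_of_nonneg fun m _ => ha m).1 h0 m
      (Finset.mem_filter.2 ⟨Finset.mem_univ m, h'⟩)
    rw [h0, hm, zero_mul]
  · rw [tsum_markWeight ha, ENNReal.ofReal_eq_zero] at h
    rw [le_antisymm h hw, zero_mul]
  · rw [tsum_markWeight ha, ENNReal.ofReal_eq_zero] at h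
    rw [PMF.normalize_apply, tsum_markWeight ha, markWeight, if_pos ‹P m = t›, ENNReal.toReal_mul,
      ENNReal.toReal_ofReal (ha m), ENNReal.toReal_inv, ENNReal.toReal_ofReal hw]
    have : classWeight a P t ≠ 0 := fun h0 => h h0.le
    field_simp
  · rw [PMF.normalize_apply, markWeight, if_neg ‹¬P m = t›]
    simp

/-- The marked branching process of a canonical partition has the law of the `n`-type branching
process. -/
theorem classBPLaw_eq_nTypeBPLaw {n K : ℕ} {A : Matrix (Fin n) (Fin n) ℝ} (hA : A.IsSymm)
    (h01 : ∀ i j, A i j = 0 ∨ A i j = 1) {P : Fin n → Fin K} (hP : IsCanonicalPartition A P)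
    {a : Fin n → ℝ} (ha : ∀ i, 0 ≤ a i) {ℓ : ℝ} (hℓ : 0 ≤ ℓ) (i₀ : Fin n) :
    classBPLaw ℓ A a P i₀
      = nTypeBPLaw ℓ (Matrix.diagonal a * A * Matrix.diagonal a) i₀ := by
  classical
  refine markedBPLaw_eq _ _ _ _ (fun i m => ?_) i₀
  have hA0 : ∀ i j, 0 ≤ A i j := fun i j => by rcases h01 i j with h | h <;> rw [h]; norm_num
  have hproxy : ∀ s t, 0 ≤ proxy A P s t := fun s t => by unfold proxy; split_ifs <;> norm_num
  -- Only the class of `m` contributes children with mark `m`.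
  have hleft : ∀ t, (((ℓ * a i * proxy A P (P i) t * classWeight a P t).toNNReal : ℝ≥0) : ℝ)
      * (markLaw a P i₀ t m).toReal = if P m = t then ℓ * (a i * A i m * a m) else 0 := by
    intro t
    rw [Real.coe_toNNReal _ (mul_nonneg (mul_nonneg (mul_nonneg hℓ (ha i)) (hproxy _ _))
      (classWeight_nonneg ha P t)), mul_assoc, classWeight_mul_markLaw ha]
    split_ifs with h
    · rw [← h, proxy_eq hA h01 hP]; ring
    · rw [mul_zero]
  have hB : ∀ j, (Matrix.diagonal a * A * Matrix.diagonal a) i j = a i * A i j * a j := by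
    intro j
    rw [Matrix.mul_diagonal, Matrix.diagonal_mul]
  have hright : ∀ j, (((ℓ * (Matrix.diagonal a * A * Matrix.diagonal a) i j).toNNReal : ℝ≥0) : ℝ)
      * ((PMF.pure j : PMF (Fin n)) m).toReal = if m = j then ℓ * (a i * A i m * a m) else 0 := by
    intro j
    rw [hB, Real.coe_toNNReal _ (mul_nonneg hℓ (mul_nonneg (mul_nonneg (ha i) (hA0 i j)) (ha j))),
      PMF.pure_apply]
    split_ifs with h
    · simp [h]
    · simp
  simp_rw [hleft, hright]
  simp

end RankOneKL

theorem mainTheorem6 :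
    ∃ f : ℕ → ℕ,
      (fun k : ℕ => (f k : ℝ)) =O[Filter.atTop] (fun k : ℕ => (2 : ℝ) ^ ((k : ℝ) / 2)) ∧
      ∀ (n k : ℕ) (A : Matrix (Fin n) (Fin n) ℝ), A.IsSymm →
        (∀ i j, A i j = 0 ∨ A i j = 1) → (∀ i, A i i = 0) → A.rank = k →
        (∃ P : Fin n → Fin (f k), RankOneKL.IsCanonicalPartition A P) ∧
        ∀ (K : ℕ) (P : Fin n → Fin K), RankOneKL.IsCanonicalPartition A P →
          ∀ (a : Fin n → ℝ), (∀ i, 0 ≤ a i) → ∀ (ℓ : ℝ), 0 ≤ ℓ → ∀ (i₀ : Fin n),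
            RankOneKL.classBPLaw ℓ A a P i₀ =
              RankOneKL.nTypeBPLaw ℓ (Matrix.diagonal a * A * Matrix.diagonal a) i₀ := by
  refine ⟨fun k => ⌈RankOneKL.rowBound k⌉₊, ?_, ?_⟩
  · refine Asymptotics.IsBigO.of_bound 2404 (Filter.Eventually.of_forall fun k => ?_)
    have hpow : (2 : ℝ) ^ ((k : ℝ) / 2) = √2 ^ k := by
      rw [Real.sqrt_eq_rpow, ← Real.rpow_natCast, ← Real.rpow_mul (by norm_num)]
      congr 1; ring
    have h0 : 0 ≤ RankOneKL.rowBound k :=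
      le_trans (by positivity) (RankOneKL.sqrt_two_pow_le_rowBound k)
    have h1 := (Nat.ceil_lt_add_one h0).le
    rw [Real.norm_of_nonneg (Nat.cast_nonneg _), Real.norm_of_nonneg (by positivity), hpow]
    unfold RankOneKL.rowBound at h1 ⊢
    linarith
  · intro n k A hA h01 _ hk
    refine ⟨RankOneKL.exists_canonicalPartition A hA h01 ?_, ?_⟩
    · rw [hk]
      exact Nat.le_ceil _
    · intro K P hP a ha ℓ hℓ i₀
      exact RankOneKL.classBPLaw_eq_nTypeBPLaw hA h01 hP ha hℓ i₀
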